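/- Let $d,m\ge 2$ be integers. For a real square matrix $A$ and $r>0$ put $r^A=\sum_{k\ge 0}\frac{(\ln r)^kA^k}{k!}$. Let $Q(\mathbb R^n)$ be the set of invertible real $n\times n$ matrices all of whose complex eigenvalues have positive real part, and $M(\mathbb R^n)$ the set of real $n\times n$ matrices all of whose complex eigenvalues have nonnegative real part and for which every eigenvalue with real part $0$ is a simple root of the minimal polynomial. $\stackrel{d}{=}$ denotes equality of all finite-dimensional distributions. Let $E\in Q(\mathbb R^d)$ and let $X=\{X(t),\,t\in\mathbb R^d\}$ be a random field with values in $\mathbb R^m$ which is stochastically continuous, proper (for every $t\neq 0$ the support of the law of $X(t)$ is not contained in any affine hyperplane of $\mathbb R^m$), and wide-sense operator-self-similar with time-variable scaling exponent $E$: for every $r>0$ there are a (non-random) $m\times m$ matrix $B(r)$ and a (non-random) function $a_r:\mathbb R^d\to\mathbb R^m$ with $$\{X(r^Et),\,t\in\mathbb R^d\}\stackrel{d}{=}\{B(r)X(t)+a_r(t),\,t\in\mathbb R^d\}.$$ Then there are a matrix $D\in M(\mathbb R^m)$ and functions $b_r:\mathbb R^d\to\mathbb R^m$, $r>0$, with $(r,t)\mapsto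 b_r(t)$ continuous on $(0,\infty)\times\mathbb R^d$, such that for all $r>0$ $$\{X(r^Et),\,t\in\mathbb R^d\}\stackrel{d}{=}\{r^DX(t)+b_r(t),\,t\in\mathbb R^d\}.\qquad(*)$$ Moreover, for every real $m\times m$ matrix $D$ and all functions $b_r:\mathbb R^d\to\mathbb R^m$ $(r>0)$ satisfying $(*)$ for all $r>0$, there is a function $b$, defined and continuous on $\mathbb R^d\setminus\{0\}$ with values in $\mathbb R^m$, such that $$b_r(t)=b(r^Et)-r^Db(t)\qquad\text{for all } r>0 \text{ and } t\in\mathbb R^d\setminus\{0\},\qquad(**)$$ and the field $Y(t)=X(t)-b(t)$, $t\in\mathbb R^d\setminus\{0\}$, is operator-self-similar with exponents $(E,D)$, that is, $\{Y(r^Et),\,t\neq 0\}\stackrel{d}{=}\{r^DY(t),\,t\ne 0\}$ for all $r>0$. If, in addition, $D\in Q(\mathbb R^m)$ and $X(0)=a$ almost surely for a constant vector $a\in\mathbb R^m$, then, after setting $b(0)=a$, the identity $(**)$ holds for all $r>0$ and all $t\in\mathbb R^d$, and $\{X(t)-b(t),\,t\in\mathbb R^d\}$ is operator-self-similar with exponents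 $(E,D)$. -/

import Mathlib

open MeasureTheory

noncomputable section

namespace OperatorScaling

/-- The Euclidean space of dimension `n`. -/
abbrev Vec (n : ℕ) : Type := EuclideanSpace ℝ (Fin n)

/-- Real square matrices, i.e. the linear operators of the Euclidean space. -/
abbrev Mat (n : ℕ) : Type := Matrix (Fin n) (Fin n) ℝ

/-- The matrix with its entries regarded as complex numbers. -/
def complexify {n : ℕ} (A : Mat n) : Matrix (Fin n) (Fin n) ℂ :=
  A.map (fun x : ℝ => (x : ℂ))

/-- The operator `r ^ A = exp ((log r) A) = ∑ (log r) ^ k A ^ k / k!` (used for `r > 0`),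
acting on the Euclidean space. -/
def opPow {n : ℕ} (r : ℝ) (A : Mat n) : Vec n →L[ℝ] Vec n :=
  Matrix.toEuclideanCLM (n := Fin n) (𝕜 := ℝ) (NormedSpace.exp (Real.log r • A))

/-- The class `Q`: invertible matrices all of whose (complex) eigenvalues have positive
real part. -/
def IsQ {n : ℕ} (A : Mat n) : Prop :=
  IsUnit A ∧ ∀ z ∈ spectrum ℂ (complexify A), 0 < z.re

/-- The class `M`: matrices all of whose (complex) eigenvalues have nonnegative real part,
those on the imaginary axis being simple roots of the minimal polynomial. -/
def IsM {n : ℕ} (A : Mat n) : Prop :=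
  ∀ z ∈ spectrum ℂ (complexify A),
    0 ≤ z.re ∧ (z.re = 0 → (minpoly ℂ (complexify A)).rootMultiplicity z = 1)

/-- Equality in distribution of two random fields with the same index set: all their
finite-dimensional distributions agree. -/
def FieldEqDist {Ω : Type*} [MeasurableSpace Ω] (P : Measure Ω) {T : Type*} {m : ℕ}
    (Y Z : T → Ω → Vec m) : Prop :=
  ∀ I : Finset T,
    P.map (fun ω (i : I) => Y i ω) = P.map (fun ω (i : I) => Z i ω)

/-- A measure is full if its support is not contained in any (affine) hyperplane
`{x | ⟪y, x⟫ = c}`, `y ≠ 0`. -/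
def IsFull {m : ℕ} (μ : Measure (Vec m)) : Prop :=
  ∀ y : Vec m, y ≠ 0 → ∀ c : ℝ, ¬ μ.support ⊆ {x | inner ℝ y x = c}

/-- A random field is proper if the law of `X t` is full for every `t ≠ 0`. -/
def IsProper {Ω : Type*} [MeasurableSpace Ω] (P : Measure Ω) {d m : ℕ}
    (X : Vec d → Ω → Vec m) : Prop :=
  ∀ t : Vec d, t ≠ 0 → IsFull (P.map (X t))

/-- Stochastic continuity: `X s → X t` in probability as `s → t`, for every `t`. -/
def IsStochasticallyContinuous {Ω : Type*} [MeasurableSpace Ω] (P : Measure Ω) {d m : ℕ}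
    (X : Vec d → Ω → Vec m) : Prop :=
  ∀ t : Vec d, TendstoInMeasure P X (nhds t) (X t)

/-- Wide-sense operator-self-similarity with time-variable scaling exponent `E`: for every
`r > 0` there are a matrix `B` and a deterministic function `a` such that the fields
`X (r ^ E t)` and `B (X t) + a t` are equal in distribution. -/
def IsWOSS {Ω : Type*} [MeasurableSpace Ω] (P : Measure Ω) {d m : ℕ}
    (E : Mat d) (X : Vec d → Ω → Vec m) : Prop :=
  ∀ r : ℝ, 0 < r → ∃ (B : Mat m) (a : Vec d → Vec m),
    FieldEqDist P (fun (t : Vec d) ω => X (opPow r E t) ω)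
      (fun (t : Vec d) ω => Matrix.toEuclideanCLM (n := Fin m) (𝕜 := ℝ) B (X t ω) + a t)

/-- For every `r > 0` the fields `X (r ^ E t)` and `r ^ D (X t) + β r t` are equal in
distribution. -/
def IsWOSSWith {Ω : Type*} [MeasurableSpace Ω] (P : Measure Ω) {d m : ℕ}
    (E : Mat d) (D : Mat m) (β : ℝ → Vec d → Vec m) (X : Vec d → Ω → Vec m) : Prop :=
  ∀ r : ℝ, 0 < r →
    FieldEqDist P (fun (t : Vec d) ω => X (opPow r E t) ω)
      (fun (t : Vec d) ω => opPow r D (X t ω) + β r t)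

/-- Operator-self-similarity with exponents `(E, D)` of a field with parameter set `S`
(a subset invariant under all `r ^ E`): for every `r > 0` the fields `Y (r ^ E t)` and
`r ^ D (Y t)`, `t ∈ S`, are equal in distribution. -/
def IsOSSOn {Ω : Type*} [MeasurableSpace Ω] (P : Measure Ω) {d m : ℕ} (S : Set (Vec d))
    (E : Mat d) (D : Mat m) (Y : Vec d → Ω → Vec m) : Prop :=
  ∀ r : ℝ, 0 < r →
    FieldEqDist P (fun (t : S) ω => Y (opPow r E t) ω)
      (fun (t : S) ω => opPow r D (Y t ω))

end OperatorScaling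

end

/-! Work in logarithmic time `s = log r`, with `A` the operator of `E`. Let `G_s` be the set of
linear parts `B` of the affine maps that carry `X` to `X(exp(sA) ·)` in law (`scalingSet`).
Properness makes every such `B` invertible, the `G_s` multiply like a group over time, and the pairs
`(s, B)` form a closed set. Tightness from stochastic continuity, together with fullness, bounds `B`
as long as one nonzero orbit point stays bounded. So each `G_s` is compact.

The exponent is a tangent direction at the identity. Take `B_n` in `G_{s_n}`, `s_n ↓ 0`, closest to
`1`, and a limit `(L, σ)` of the normalised pairs `(B_n - 1, s_n)`. Large powers of `B_n` put
`exp(τL)` in `G_{τσ}` for `τ ≥ 0`. Minimality rules out `σ = 0`, so `L / σ` generates a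
one-parameter group of scaling operators (`exists_expFlow_mem_scalingSet`). Since `E` is in `Q`,
backward orbits are bounded, hence so is `exp(-uD)` for `u ≥ 0`; the action on generalised
eigenvectors then forces `D` into `M`.

A law determines its deterministic shift (`shift_unique`), and shifts between sequences converging
in measure converge (`shift_tendsto`). Hence the shifts form a jointly continuous cocycle over the
flow of `A`. That flow is contracting backwards, so off the origin it has a continuous radial
coordinate `h` with `h(exp(sA)t) = s + h(t)` (`exists_radial`). Transporting from the section `h =
0` writes the cocycle as the coboundary of a continuous `b`, and subtracting `b` from `X` removes
the shifts. -/

namespace OperatorScaling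

open Filter Topology

/-! ### Convergence in measure, deterministic shifts and full laws. -/

section Probability

variable {Ω : Type*} [MeasurableSpace Ω] {P : Measure Ω}

/-- Convergence in measure of all components implies convergence in measure of the tuple. -/
theorem tendstoInMeasure_pi {ι κ V : Type*} [Fintype ι] [PseudoEMetricSpace V] {l : Filter κ}
    {F : ι → κ → Ω → V} {G : ι → Ω → V} (h : ∀ i, TendstoInMeasure P (F i) l (G i)) :
    TendstoInMeasure P (fun n ω i => F i n ω) l (fun ω i => G i ω) := by
  intro ε hε
  have hsum : Tendsto (fun n => ∑ i, P {ω | ε ≤ edist (F i n ω) (G i ω)}) l (𝓝 0) := by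
    simpa using tendsto_finsetSum Finset.univ (fun i _ => h i ε hε)
  refine tendsto_of_tendsto_of_tendsto_of_le_of_le tendsto_const_nhds hsum
    (fun _ => bot_le) fun n => ?_
  refine (measure_mono ?_).trans (measure_iUnion_fintype_le P _)
  intro ω hω
  simp only [Set.mem_ofPred_eq, edist_pi_def, Set.mem_iUnion] at hω ⊢
  by_contra! hcon
  refine absurd hω (not_le.2 ?_)
  exact (Finset.sup_lt_iff (by simpa using hε)).2 fun i _ => hcon i

/-- Continuous mapping theorem for convergence in measure, with a convergent parameter. -/
theorem tendstoInMeasure_continuous_param [IsFiniteMeasure P] {C V W : Type*} [TopologicalSpace C]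
    [PseudoEMetricSpace V] [PseudoEMetricSpace W]
    {c : ℕ → C} {c₀ : C} (hc : Tendsto c atTop (𝓝 c₀)) {F : ℕ → Ω → V} {G : Ω → V}
    (hF : TendstoInMeasure P F atTop G) {g : C → V → W} (hg : Continuous fun p : C × V => g p.1 p.2)
    (hmeas : ∀ n, AEStronglyMeasurable (fun ω => g (c n) (F n ω)) P) :
    TendstoInMeasure P (fun n ω => g (c n) (F n ω)) atTop (fun ω => g c₀ (G ω)) := by
  -- The subsequence criterion reduces the claim to almost sure convergence, where continuity
  -- applies pointwise.
  rw [exists_seq_tendstoInMeasure_atTop_iff hmeas]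
  intro ns hns
  obtain ⟨ms, hms, hae⟩ := (hF.comp hns.tendsto_atTop).exists_seq_tendsto_ae
  refine ⟨ms, hms, hae.mono fun ω hω => ?_⟩
  have hpair := ((hc.comp (hns.tendsto_atTop.comp hms.tendsto_atTop)).prodMk_nhds hω)
  exact (hg.tendsto (c₀, G ω)).comp hpair

/-- Equality of laws passes to limits in measure. -/
theorem map_eq_of_tendstoInMeasure [IsProbabilityMeasure P] {V : Type*} [PseudoEMetricSpace V]
    [MeasurableSpace V] [BorelSpace V] {U U' : ℕ → Ω → V} {Y Y' : Ω → V}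
    (hU : TendstoInMeasure P U atTop Y) (hU' : TendstoInMeasure P U' atTop Y')
    (hm : ∀ n, Measurable (U n)) (hm' : ∀ n, Measurable (U' n))
    (h : ∀ n, P.map (U n) = P.map (U' n)) : P.map Y = P.map Y' := by
  have h1 := hU.tendstoInDistribution (fun n => (hm n).aemeasurable)
  have h2 := hU'.tendstoInDistribution (fun n => (hm' n).aemeasurable)
  refine tendstoInDistribution_unique U h1 ⟨h1.forall_aemeasurable, h2.aemeasurable_limit, ?_⟩
  exact h2.tendsto.congr fun n => Subtype.ext (h n).symm

theorem tendstoInMeasure_const {V : Type*} [NormedAddCommGroup V] {l : Filter ℕ} (Y : Ω → V) :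
    TendstoInMeasure P (fun _ : ℕ => Y) l Y := by
  rw [tendstoInMeasure_iff_norm]
  intro ε hε
  simpa [not_le.2 hε] using tendsto_const_nhds

section Shift

variable [IsProbabilityMeasure P] {V : Type*} [NormedAddCommGroup V] [MeasurableSpace V]
  [BorelSpace V]

/-- A sequence converging in measure is tight. -/
theorem exists_norm_bound_of_tendstoInMeasure {Y : ℕ → Ω → V} {Y₀ : Ω → V}
    (hY : TendstoInMeasure P Y atTop Y₀) (hY₀ : Measurable Y₀) {ε : ENNReal} (hε : 0 < ε) :
    ∃ K : ℝ, ∀ᶠ n in atTop, P {ω | K ≤ ‖Y n ω‖} < ε := by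
  have hε2 : 0 < ε / 2 := ENNReal.half_pos hε.ne'
  obtain ⟨K, hK⟩ : ∃ K : ℕ, P {ω | (K : ℝ) ≤ ‖Y₀ ω‖} < ε / 2 := by
    have hanti : Antitone fun K : ℕ => {ω | (K : ℝ) ≤ ‖Y₀ ω‖} := by
      intro a b hab ω hω
      have hω' : (b : ℝ) ≤ ‖Y₀ ω‖ := hω
      have hab' : (a : ℝ) ≤ b := by exact_mod_cast hab
      exact hab'.trans hω'
    have hlim := tendsto_measure_iInter_atTop (μ := P) (s := fun K : ℕ => {ω | (K : ℝ) ≤ ‖Y₀ ω‖})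
      (fun K => (measurableSet_le measurable_const hY₀.norm).nullMeasurableSet) hanti
      ⟨0, measure_ne_top _ _⟩
    have hemp : (⋂ K : ℕ, {ω | (K : ℝ) ≤ ‖Y₀ ω‖}) = ∅ := by
      ext ω
      simp only [Set.mem_iInter, Set.mem_ofPred_eq, Set.mem_empty_iff_false, iff_false, not_forall,
        not_le]
      exact exists_nat_gt _
    rw [hemp, measure_empty] at hlim
    exact (hlim.eventually_lt_const hε2).exists
  refine ⟨K + 1, ?_⟩
  have h1 := (tendstoInMeasure_iff_norm.1 hY 1 one_pos).eventually_lt_const hε2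
  filter_upwards [h1] with n hn
  calc P {ω | (K : ℝ) + 1 ≤ ‖Y n ω‖}
      ≤ P ({ω | 1 ≤ ‖Y n ω - Y₀ ω‖} ∪ {ω | (K : ℝ) ≤ ‖Y₀ ω‖}) := by
        refine measure_mono fun ω hω => ?_
        by_contra hcon
        simp only [Set.mem_union, Set.mem_ofPred_eq, not_or, not_le] at hcon hω
        have := norm_le_norm_add_norm_sub' (Y n ω) (Y₀ ω)
        linarith [hcon.1, hcon.2]
    _ ≤ _ := measure_union_le _ _
    _ < ε / 2 + ε / 2 := ENNReal.add_lt_add hn hK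
    _ = ε := ENNReal.add_halves ε

/-- Deterministic shifts between two tight sequences are bounded. -/
theorem shift_bounded [SecondCountableTopology V] {Y Z : ℕ → Ω → V} {Y₀ Z₀ : Ω → V} {a : ℕ → V}
    (hY : TendstoInMeasure P Y atTop Y₀) (hZ : TendstoInMeasure P Z atTop Z₀)
    (hYm : ∀ n, Measurable (Y n)) (hZm : ∀ n, Measurable (Z n))
    (hY₀ : Measurable Y₀) (hZ₀ : Measurable Z₀)
    (h : ∀ n, P.map (Y n) = P.map (fun ω => Z n ω + a n)) :
    ∃ K : ℝ, ∀ᶠ n in atTop, ‖a n‖ ≤ K := by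
  obtain ⟨K, hK⟩ := exists_norm_bound_of_tendstoInMeasure hY hY₀ (ε := 1 / 2) (by simp)
  obtain ⟨K', hK'⟩ := exists_norm_bound_of_tendstoInMeasure hZ hZ₀ (ε := 1 / 2) (by simp)
  refine ⟨K + K', ?_⟩
  filter_upwards [hK, hK'] with n h1 h2
  have hset : MeasurableSet {x : V | K ≤ ‖x‖} := measurableSet_le measurable_const measurable_norm
  have h3 : P {ω | K ≤ ‖Z n ω + a n‖} < 1 / 2 := by
    have := congrArg (fun μ => μ {x : V | K ≤ ‖x‖}) (h n)
    simp only [Measure.map_apply (hYm n) hset,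
      Measure.map_apply ((hZm n).add_const (a n)) hset] at this
    rw [Set.preimage_ofPred_eq, Set.preimage_ofPred_eq] at this
    rwa [← this]
  -- Two events of probability below one half cannot cover the space; at a point outside both, `a n`
  -- is a difference of two bounded vectors.
  have h4 : P ({ω | K ≤ ‖Z n ω + a n‖} ∪ {ω | K' ≤ ‖Z n ω‖}) < 1 := by
    refine (measure_union_le _ _).trans_lt ?_
    calc _ < (1 / 2 : ENNReal) + 1 / 2 := ENNReal.add_lt_add h3 h2
      _ = 1 := ENNReal.add_halves 1
  obtain ⟨ω, hω⟩ : ∃ ω, ω ∉ ({ω | K ≤ ‖Z n ω + a n‖} ∪ {ω | K' ≤ ‖Z n ω‖}) := by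
    by_contra! hcon
    rw [Set.eq_univ_of_forall hcon, measure_univ] at h4
    exact lt_irrefl _ h4
  simp only [Set.mem_union, Set.mem_ofPred_eq, not_or, not_le] at hω
  calc ‖a n‖ = ‖(Z n ω + a n) - Z n ω‖ := by simp
    _ ≤ ‖Z n ω + a n‖ + ‖Z n ω‖ := norm_sub_le _ _
    _ ≤ K + K' := by linarith [hω.1, hω.2]

/-- The law of a random vector determines a deterministic shift. -/
theorem shift_unique [SecondCountableTopology V] [NormedSpace ℝ V] {Z : Ω → V} (hZ : Measurable Z)
    {a b : V} (h : P.map (fun ω => Z ω + a) = P.map (fun ω => Z ω + b)) : a = b := by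
  -- The equality of laws iterates to shifts by all multiples of `b - a`, which must stay bounded,
  -- so `b - a` vanishes.
  have key : ∀ n : ℕ, P.map Z = P.map (fun ω => Z ω + n • (b - a)) := by
    have h1 : P.map Z = P.map (fun ω => Z ω + (b - a)) := by
      have := congrArg (fun μ => μ.map (fun x : V => x - a)) h
      rw [Measure.map_map (by fun_prop) (by fun_prop),
        Measure.map_map (by fun_prop) (by fun_prop)] at this
      convert this using 2
      · ext ω; simp
      · ext ω; simp [add_sub_assoc]
    intro n
    induction n with
    | zero => simp
    | succ n ih =>
      have := congrArg (fun μ => μ.map (fun x : V => x + (b - a))) ih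
      rw [Measure.map_map (by fun_prop) (by fun_prop),
        Measure.map_map (by fun_prop) (by fun_prop)] at this
      refine h1.trans (Eq.trans this ?_)
      congr 1
      ext ω
      simp [add_smul, add_assoc]
  obtain ⟨K, hK⟩ := shift_bounded (tendstoInMeasure_const Z) (tendstoInMeasure_const Z)
    (fun _ => hZ) (fun _ => hZ) hZ hZ key
  by_contra hne
  have hpos : 0 < ‖b - a‖ := norm_pos_iff.2 (sub_ne_zero.2 (Ne.symm hne))
  have hlim : Tendsto (fun n : ℕ => ‖(n : ℕ) • (b - a)‖) atTop atTop := by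
    simp only [← Nat.cast_smul_eq_nsmul ℝ, norm_smul, Real.norm_natCast]
    exact tendsto_natCast_atTop_atTop.atTop_mul_const hpos
  obtain ⟨n, h1, h2⟩ := (hK.and (hlim.eventually_gt_atTop K)).exists
  linarith

/-- Deterministic shifts between two sequences converging in measure converge. -/
theorem shift_tendsto [NormedSpace ℝ V] [FiniteDimensional ℝ V] {Y Z : ℕ → Ω → V}
    {Y₀ Z₀ : Ω → V} {a : ℕ → V}
    (hY : TendstoInMeasure P Y atTop Y₀) (hZ : TendstoInMeasure P Z atTop Z₀)
    (hYm : ∀ n, Measurable (Y n)) (hZm : ∀ n, Measurable (Z n))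
    (hY₀ : Measurable Y₀) (hZ₀ : Measurable Z₀)
    (h : ∀ n, P.map (Y n) = P.map (fun ω => Z n ω + a n)) :
    ∃ a₀, Tendsto a atTop (𝓝 a₀) ∧ P.map Y₀ = P.map (fun ω => Z₀ ω + a₀) := by
  have : ProperSpace V := FiniteDimensional.proper ℝ V
  -- Every subsequence has a convergent further subsequence by boundedness; all limits satisfy the
  -- same equation in law, so `shift_unique` identifies them.
  have hsub : ∀ ns : ℕ → ℕ, Tendsto ns atTop atTop → ∃ (a₀ : V) (ms : ℕ → ℕ), StrictMono ms ∧
      Tendsto (fun n => a (ns (ms n))) atTop (𝓝 a₀) ∧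
      P.map Y₀ = P.map (fun ω => Z₀ ω + a₀) := by
    intro ns hns
    obtain ⟨K, hK⟩ := shift_bounded hY hZ hYm hZm hY₀ hZ₀ h
    obtain ⟨a₀, -, ms, hms, hlim⟩ := tendsto_subseq_of_frequently_bounded
      (Metric.isBounded_closedBall (x := (0 : V)) (r := K)) (x := fun n => a (ns n))
      ((hns.eventually hK).mono fun n hn => mem_closedBall_zero_iff.2 hn).frequently
    refine ⟨a₀, ms, hms, hlim, ?_⟩
    have hc := hns.comp hms.tendsto_atTop
    refine map_eq_of_tendstoInMeasure (hY.comp hc)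
      (tendstoInMeasure_continuous_param hlim (hZ.comp hc) (g := fun c x => x + c) (by fun_prop)
        fun n => ?_) (fun n => hYm _) (fun n => ?_) fun n => h _
    · exact (((hZm _).add_const _)).aestronglyMeasurable
    · exact (hZm _).add_const _
  obtain ⟨a₀, -, -, -, ha₀⟩ := hsub id tendsto_id
  refine ⟨a₀, tendsto_of_subseq_tendsto fun ns hns => ?_, ha₀⟩
  obtain ⟨a₁, ms, -, hlim, ha₁⟩ := hsub ns hns
  have : a₁ = a₀ := shift_unique hZ₀ (ha₁.symm.trans ha₀)
  exact ⟨ms, this ▸ hlim⟩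

end Shift

/-- A hyperplane is closed, so if it had full measure it would contain the support. -/
theorem IsFull.not_ae_inner_eq {m : ℕ} {Y : Ω → Vec m} (hY : Measurable Y)
    (h : IsFull (P.map Y)) {y : Vec m} (hy : y ≠ 0) (c : ℝ) : ¬ ∀ᵐ ω ∂P, inner ℝ y (Y ω) = c := by
  intro hae
  refine h y hy c (Measure.support_subset_of_isClosed ?_ ?_)
  · exact isClosed_eq (by fun_prop) continuous_const
  · have hs : MeasurableSet {x : Vec m | inner ℝ y x = c} :=
      measurableSet_eq_fun (by fun_prop) measurable_const
    exact (ae_map_iff hY.aemeasurable hs).2 hae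

/-- A nonzero operator does not map a full random vector to a constant. -/
theorem IsFull.not_ae_apply_eq {m : ℕ} {Y : Ω → Vec m} (hY : Measurable Y)
    (h : IsFull (P.map Y)) {C : Vec m →L[ℝ] Vec m} (hC : C ≠ 0) (c : Vec m) :
    ¬ ∀ᵐ ω ∂P, C (Y ω) = c := by
  intro hae
  obtain ⟨y, hy⟩ : ∃ y, C.adjoint y ≠ 0 := by
    by_contra! hcon
    refine hC ?_
    have : C.adjoint = 0 := ContinuousLinearMap.ext hcon
    simpa using this
  refine h.not_ae_inner_eq hY hy (inner ℝ y c) (hae.mono fun ω hω => ?_)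
  rw [ContinuousLinearMap.adjoint_inner_left, hω]

end Probability

/-! ### One-parameter groups in a Banach algebra. -/

section ExpFlow

variable {𝔸 : Type*} [NormedRing 𝔸] [NormedAlgebra ℝ 𝔸]

/-- The one-parameter group `s ↦ exp (s a)`. -/
noncomputable def expFlow (a : 𝔸) (s : ℝ) : 𝔸 := NormedSpace.exp (s • a)

theorem expFlow_zero (a : 𝔸) : expFlow a 0 = 1 := by
  simp [expFlow]

theorem expFlow_smul (a : 𝔸) (c s : ℝ) : expFlow (c • a) s = expFlow a (s * c) := by
  rw [expFlow, expFlow, smul_smul]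

theorem smul_sub_one_mul_add (c : ℝ) (x y : 𝔸) :
    (c • (x - 1)) * y + c • (y - 1) = c • (x * y - 1) := by
  rw [smul_mul_assoc, ← smul_add, sub_mul, one_mul, sub_add_sub_cancel]

variable [CompleteSpace 𝔸]

theorem expFlow_add (a : 𝔸) (s u : ℝ) : expFlow a (s + u) = expFlow a s * expFlow a u := by
  let _ : NormedAlgebra ℚ 𝔸 := NormedAlgebra.restrictScalars ℚ ℝ 𝔸
  rw [expFlow, add_smul,
    NormedSpace.exp_add_of_commute (((Commute.refl a).smul_left s).smul_right u)]
  rfl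

theorem expFlow_mul_neg (a : 𝔸) (s : ℝ) : expFlow a s * expFlow a (-s) = 1 := by
  rw [← expFlow_add, add_neg_cancel, expFlow_zero]

theorem expFlow_neg_mul (a : 𝔸) (s : ℝ) : expFlow a (-s) * expFlow a s = 1 := by
  rw [← expFlow_add, neg_add_cancel, expFlow_zero]

theorem expFlow_pow (a : 𝔸) (s : ℝ) (k : ℕ) : expFlow a s ^ k = expFlow a (k * s) := by
  induction k with
  | zero => simp [expFlow_zero]
  | succ k ih => rw [pow_succ, ih, ← expFlow_add, Nat.cast_succ, add_one_mul]

@[fun_prop]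
theorem continuous_expFlow (a : 𝔸) : Continuous (expFlow a) := by
  let _ : NormedAlgebra ℚ 𝔸 := NormedAlgebra.restrictScalars ℚ ℝ 𝔸
  exact NormedSpace.exp_continuous.comp (continuous_id.smul continuous_const)

theorem tendsto_expFlow_sub_one_div (a : 𝔸) {c : ℕ → ℝ} (hc : Tendsto c atTop (𝓝 0))
    (hpos : ∀ n, 0 < c n) :
    Tendsto (fun n => (c n)⁻¹ • (expFlow a (c n) - 1)) atTop (𝓝 a) := by
  have h1 := hasDerivAt_exp_smul_const (𝕂 := ℝ) a (0 : ℝ)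
  simp only [zero_smul, NormedSpace.exp_zero, one_mul] at h1
  have h2 := (hasDerivAt_iff_tendsto_slope_zero.1 h1).comp
    (tendsto_nhdsWithin_iff.2 ⟨hc, Eventually.of_forall fun n => (hpos n).ne'⟩)
  refine h2.congr fun n => ?_
  simp [expFlow]

theorem tendsto_expFlow_neg_sub_one_div (a : 𝔸) {c : ℕ → ℝ} (hc : Tendsto c atTop (𝓝 0))
    (hpos : ∀ n, 0 < c n) :
    Tendsto (fun n => (c n)⁻¹ • (expFlow a (-c n) - 1)) atTop (𝓝 (-a)) := by
  have := tendsto_expFlow_sub_one_div ((-1 : ℝ) • a) hc hpos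
  simp only [expFlow_smul, mul_neg, mul_one] at this
  rwa [neg_one_smul] at this

end ExpFlow

/-! ### Equality of finite-dimensional distributions and scaling operators. -/

section Fields

variable {Ω : Type*} [MeasurableSpace Ω] {P : Measure Ω}

namespace FieldEqDist

variable {T : Type*} {m : ℕ} {Y Z W : T → Ω → Vec m}

theorem symm (h : FieldEqDist P Y Z) : FieldEqDist P Z Y := fun I => (h I).symm

theorem trans (h : FieldEqDist P Y Z) (h' : FieldEqDist P Z W) : FieldEqDist P Y W :=
  fun I => (h I).trans (h' I)

theorem reindex (h : FieldEqDist P Y Z) (hY : ∀ t, Measurable (Y t)) (hZ : ∀ t, Measurable (Z t))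
    {S : Type*} (f : S → T) : FieldEqDist P (fun s => Y (f s)) (fun s => Z (f s)) := by
  classical
  intro I
  have key := congrArg (fun μ => μ.map (fun (x : ↥(Finset.image f I) → Vec m) (i : I) =>
    x ⟨f i, Finset.mem_image_of_mem f i.2⟩)) (h (Finset.image f I))
  rwa [Measure.map_map (by fun_prop) (by fun_prop),
    Measure.map_map (by fun_prop) (by fun_prop)] at key

theorem map {m' : ℕ} (h : FieldEqDist P Y Z) (hY : ∀ t, Measurable (Y t))
    (hZ : ∀ t, Measurable (Z t)) {g : T → Vec m → Vec m'} (hg : ∀ t, Measurable (g t)) :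
    FieldEqDist P (fun t ω => g t (Y t ω)) (fun t ω => g t (Z t ω)) := by
  intro I
  have key := congrArg (fun μ => μ.map (fun (x : I → Vec m) (i : I) => g i (x i))) (h I)
  rwa [Measure.map_map (by fun_prop) (by fun_prop),
    Measure.map_map (by fun_prop) (by fun_prop)] at key

theorem law_eq (h : FieldEqDist P Y Z) (hY : ∀ t, Measurable (Y t)) (hZ : ∀ t, Measurable (Z t))
    (t : T) : P.map (Y t) = P.map (Z t) := by
  have key := congrArg (fun μ => μ.map (fun x : (({t} : Finset T) → Vec m) =>
    x ⟨t, Finset.mem_singleton_self t⟩)) (h {t})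
  rwa [Measure.map_map (by fun_prop) (by fun_prop),
    Measure.map_map (by fun_prop) (by fun_prop)] at key

/-- Equality of finite-dimensional distributions passes to limits in measure. -/
theorem of_tendsto [IsProbabilityMeasure P] {U V : ℕ → T → Ω → Vec m}
    (hU : ∀ t, TendstoInMeasure P (fun n => U n t) atTop (Y t))
    (hV : ∀ t, TendstoInMeasure P (fun n => V n t) atTop (Z t))
    (hUm : ∀ n t, Measurable (U n t)) (hVm : ∀ n t, Measurable (V n t))
    (h : ∀ n, FieldEqDist P (U n) (V n)) : FieldEqDist P Y Z := fun I =>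
  map_eq_of_tendstoInMeasure (tendstoInMeasure_pi fun i : I => hU i)
    (tendstoInMeasure_pi fun i : I => hV i) (fun n => measurable_pi_lambda _ fun i => hUm n i)
    (fun n => measurable_pi_lambda _ fun i => hVm n i) fun n => h n I

end FieldEqDist

theorem IsStochasticallyContinuous.tendsto {d m : ℕ} {X : Vec d → Ω → Vec m}
    (hX : IsStochasticallyContinuous P X) {x : ℕ → Vec d} {x₀ : Vec d}
    (hx : Tendsto x atTop (𝓝 x₀)) :
    TendstoInMeasure P (fun n => X (x n)) atTop (X x₀) := (hX x₀).comp hx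

section Scaling

variable {d m : ℕ} {X : Vec d → Ω → Vec m}

/-- Affine rescalings of a full random vector into the (tight) laws of a stochastically continuous
field over a ball have bounded linear parts. -/
theorem exists_norm_bound_of_law_eq [IsProbabilityMeasure P] (hXm : ∀ t, Measurable (X t))
    (hXc : IsStochasticallyContinuous P X) {Y : Ω → Vec m} (hY : Measurable Y)
    (hfull : IsFull (P.map Y)) (R : ℝ) :
    ∃ C : ℝ, ∀ x : Vec d, ‖x‖ ≤ R → ∀ (B : Vec m →L[ℝ] Vec m) (a : Vec m),
      P.map (X x) = P.map (fun ω => B (Y ω) + a) → ‖B‖ ≤ C := by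
  -- If the norms blow up, divide by them: along a subsequence the left side tends to `0` and `B /
  -- ‖B‖` to some `C` of norm one. Then `C Y` is almost surely constant, against fullness.
  by_contra! hcon
  choose x hx B a hlaw hB using fun n : ℕ => hcon n
  have hBpos : ∀ n, 0 < ‖B n‖ := fun n => (Nat.cast_nonneg n).trans_lt (hB n)
  obtain ⟨x₀, -, φ, hφ, hxlim⟩ := tendsto_subseq_of_bounded
    (Metric.isBounded_closedBall (x := (0 : Vec d)) (r := R)) (x := x)
    fun n => mem_closedBall_zero_iff.2 (hx n)
  have hsph : ∀ n, ‖B (φ n)‖⁻¹ • B (φ n) ∈ Metric.sphere (0 : Vec m →L[ℝ] Vec m) 1 := fun n => by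
    rw [mem_sphere_zero_iff_norm, norm_smul, norm_inv, norm_norm,
      inv_mul_cancel₀ (hBpos _).ne']
  obtain ⟨C, hC, ψ, hψ, hClim⟩ := (isCompact_sphere (0 : Vec m →L[ℝ] Vec m) 1).tendsto_subseq hsph
  have hθ : Tendsto (fun n => φ (ψ n)) atTop atTop := hφ.tendsto_atTop.comp hψ.tendsto_atTop
  have hinv : Tendsto (fun n => ‖B (φ (ψ n))‖⁻¹) atTop (𝓝 0) := by
    have h1 : Tendsto (fun n => ‖B n‖) atTop atTop :=
      tendsto_atTop_mono (fun n => (hB n).le) tendsto_natCast_atTop_atTop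
    exact (tendsto_inv_atTop_zero.comp h1).comp hθ
  have hYn := tendstoInMeasure_continuous_param hinv
    (hXc.tendsto (hxlim.comp hψ.tendsto_atTop)) (g := fun (c : ℝ) (v : Vec m) => c • v)
    (by fun_prop)
    (fun n => ((hXm (x (φ (ψ n)))).const_smul ‖B (φ (ψ n))‖⁻¹).aestronglyMeasurable)
  have hZn := tendstoInMeasure_continuous_param hClim (tendstoInMeasure_const (P := P) Y)
    (g := fun (L : Vec m →L[ℝ] Vec m) (v : Vec m) => L v) (by fun_prop)
    (fun n => by
      have := (‖B (φ (ψ n))‖⁻¹ • B (φ (ψ n))).continuous.measurable.comp hY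
      exact this.aestronglyMeasurable)
  have hCne : C ≠ 0 := by
    rintro rfl
    simp at hC
  obtain ⟨α, -, hα⟩ := shift_tendsto (a := fun n => ‖B (φ (ψ n))‖⁻¹ • a (φ (ψ n))) hYn hZn
    (fun n => (hXm (x (φ (ψ n)))).const_smul ‖B (φ (ψ n))‖⁻¹)
    (fun n => (‖B (φ (ψ n))‖⁻¹ • B (φ (ψ n))).continuous.measurable.comp hY)
    ((hXm x₀).const_smul (0 : ℝ)) (C.continuous.measurable.comp hY) (fun n => by
      have key := congrArg (fun μ => μ.map (fun v : Vec m => ‖B (φ (ψ n))‖⁻¹ • v))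
        (hlaw (φ (ψ n)))
      rw [Measure.map_map (by fun_prop) (hXm _),
        Measure.map_map (by fun_prop) (by fun_prop)] at key
      refine key.trans ?_
      congr 1
      ext ω
      simp)
  refine hfull.not_ae_apply_eq hY hCne (-α) ?_
  have hs : MeasurableSet {v : Vec m | v = 0} := measurableSet_singleton 0
  have h0 : ∀ᵐ v ∂P.map (fun ω => C (Y ω) + α), v = 0 := by
    rw [← hα, ae_map_iff (by fun_prop) hs]
    simp
  rw [ae_map_iff (by fun_prop) hs] at h0
  exact h0.mono fun ω hω => eq_neg_of_add_eq_zero_left hω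

variable (P) in
/-- The linear parts `B` of the affine maps relating the field along `exp (s A)` to the field. -/
def scalingSet (A : Vec d →L[ℝ] Vec d) (X : Vec d → Ω → Vec m) (s : ℝ) :
    Set (Vec m →L[ℝ] Vec m) :=
  {B | ∃ a : Vec d → Vec m, FieldEqDist P (fun t ω => X (expFlow A s t) ω)
    (fun t ω => B (X t ω) + a t)}

theorem expFlow_add_apply (A : Vec d →L[ℝ] Vec d) (s u : ℝ) (t : Vec d) :
    expFlow A (s + u) t = expFlow A s (expFlow A u t) := by
  rw [expFlow_add]
  rfl

theorem expFlow_neg_apply (A : Vec d →L[ℝ] Vec d) (s : ℝ) (t : Vec d) :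
    expFlow A s (expFlow A (-s) t) = t := by
  rw [← expFlow_add_apply, add_neg_cancel, expFlow_zero]
  rfl

variable {A : Vec d →L[ℝ] Vec d}

theorem one_mem_scalingSet : 1 ∈ scalingSet P A X 0 :=
  ⟨0, fun I => by simp [expFlow_zero]⟩

theorem mul_mem_scalingSet (hXm : ∀ t, Measurable (X t)) {s u : ℝ} {B C : Vec m →L[ℝ] Vec m}
    (hB : B ∈ scalingSet P A X s) (hC : C ∈ scalingSet P A X u) :
    B * C ∈ scalingSet P A X (s + u) := by
  obtain ⟨a, ha⟩ := hB
  obtain ⟨c, hc⟩ := hC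
  refine ⟨fun t => B (c t) + a (expFlow A u t), ?_⟩
  have h1 := ha.reindex (fun _ => hXm _) (fun _ => by fun_prop)
    (fun t => expFlow A u t)
  have h2 := hc.map (fun _ => hXm _) (fun _ => by fun_prop)
    (g := fun t v => B v + a (expFlow A u t)) (fun _ => by fun_prop)
  have h3 := h1.trans h2
  convert h3 using 3
  · rw [expFlow_add_apply]
  · simp [add_assoc]

theorem pow_mem_scalingSet (hXm : ∀ t, Measurable (X t)) {s : ℝ} {B : Vec m →L[ℝ] Vec m}
    (hB : B ∈ scalingSet P A X s) (k : ℕ) : B ^ k ∈ scalingSet P A X (k * s) := by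
  induction k with
  | zero => simpa using one_mem_scalingSet
  | succ k ih =>
    have := mul_mem_scalingSet hXm ih hB
    rwa [← pow_succ, ← add_one_mul, ← Nat.cast_succ] at this

theorem mem_scalingSet_of_mul_eq_one (hXm : ∀ t, Measurable (X t)) {s : ℝ}
    {B C : Vec m →L[ℝ] Vec m} (hB : B ∈ scalingSet P A X s) (hCB : C * B = 1) :
    C ∈ scalingSet P A X (-s) := by
  obtain ⟨a, ha⟩ := hB
  refine ⟨fun t => - C (a (expFlow A (-s) t)), ?_⟩
  have h1 := ha.reindex (fun _ => hXm _) (fun _ => by fun_prop)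
    (fun t => expFlow A (-s) t)
  have h2 := h1.map (fun _ => hXm _) (fun _ => by fun_prop)
    (g := fun t v => C v - C (a (expFlow A (-s) t))) (fun _ => by fun_prop)
  have hCB' : ∀ v, C (B v) = v := fun v => by
    have := congrArg (fun L : Vec m →L[ℝ] Vec m => L v) hCB
    simpa using this
  convert h2.symm using 3
  · simp [hCB']
  · rw [expFlow_neg_apply, sub_eq_add_neg]

/-- If the adjoint of `B` kills `y ≠ 0`, then the rescaled field at `t` has constant inner product
with `y`. This contradicts properness at the nonzero point `exp(sA)t`, so the adjoint is injective,
hence invertible. -/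
theorem isUnit_of_mem_scalingSet (hXm : ∀ t, Measurable (X t)) (hd : 0 < d)
    (hXp : IsProper P X) {s : ℝ} {B : Vec m →L[ℝ] Vec m} (hB : B ∈ scalingSet P A X s) :
    IsUnit B := by
  obtain ⟨a, ha⟩ := hB
  have hadj : Function.Injective B.adjoint := by
    rw [injective_iff_map_eq_zero]
    intro y hy
    by_contra hne
    set t : Vec d := EuclideanSpace.single ⟨0, hd⟩ 1
    have ht : t ≠ 0 := by simp [t]
    have ht' : expFlow A s t ≠ 0 := by
      intro h0
      refine ht ?_
      have := expFlow_neg_apply A (-s) t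
      rw [neg_neg, h0, map_zero] at this
      exact this.symm
    refine (hXp _ ht').not_ae_inner_eq (hXm _) hne (inner ℝ y (a t)) ?_
    have hlaw := ha.law_eq (fun _ => hXm _) (fun _ => by fun_prop) t
    have hs : MeasurableSet {x : Vec m | inner ℝ y x = inner ℝ y (a t)} :=
      measurableSet_eq_fun (by fun_prop) measurable_const
    refine (ae_map_iff (hXm _).aemeasurable hs).1 ?_
    rw [hlaw, ae_map_iff (by fun_prop) hs]
    refine Eventually.of_forall fun ω => ?_
    rw [inner_add_right, ← ContinuousLinearMap.adjoint_inner_left, hy, inner_zero_left, zero_add]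
  have hU : IsUnit B.adjoint := by
    rw [ContinuousLinearMap.isUnit_iff_bijective]
    exact ⟨hadj, (LinearMap.injective_iff_surjective (f := B.adjoint.toLinearMap)).1 hadj⟩
  have := hU.star
  rwa [← ContinuousLinearMap.star_eq_adjoint, star_star] at this

/-- No control of the shifts is needed beforehand: `shift_tendsto` makes them converge once times
and linear parts do. -/
theorem mem_scalingSet_of_tendsto [IsProbabilityMeasure P] (hXm : ∀ t, Measurable (X t))
    (hXc : IsStochasticallyContinuous P X) {s : ℕ → ℝ} {s₀ : ℝ}
    {B : ℕ → Vec m →L[ℝ] Vec m} {B₀ : Vec m →L[ℝ] Vec m} (hs : Tendsto s atTop (𝓝 s₀))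
    (hB : Tendsto B atTop (𝓝 B₀)) (h : ∀ n, B n ∈ scalingSet P A X (s n)) :
    B₀ ∈ scalingSet P A X s₀ := by
  choose a ha using h
  have hY : ∀ t, TendstoInMeasure P (fun n => X (expFlow A (s n) t)) atTop
      (X (expFlow A s₀ t)) := fun t => by
    refine hXc.tendsto ?_
    have hcont : Continuous fun u : ℝ => expFlow A u t := by fun_prop
    exact (hcont.tendsto s₀).comp hs
  have hZ : ∀ t, TendstoInMeasure P (fun n ω => B n (X t ω)) atTop (fun ω => B₀ (X t ω)) :=
    fun t => tendstoInMeasure_continuous_param hB (tendstoInMeasure_const (P := P) (X t))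
      (g := fun (L : Vec m →L[ℝ] Vec m) (v : Vec m) => L v) (by fun_prop)
      (fun n => ((B n).continuous.measurable.comp (hXm t)).aestronglyMeasurable)
  have hlim : ∀ t, ∃ a₀, Tendsto (fun n => a n t) atTop (𝓝 a₀) ∧ _ := fun t =>
    shift_tendsto (hY t) (hZ t) (fun n => hXm _) (fun n => by fun_prop) (hXm _) (by fun_prop)
      (fun n => (ha n).law_eq (fun _ => hXm _) (fun _ => by fun_prop) t)
  choose a₀ ha₀ _ using hlim
  refine ⟨a₀, FieldEqDist.of_tendsto hY (fun t => ?_) (fun n t => hXm _) (fun n t => ?_) ha⟩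
  · exact tendstoInMeasure_continuous_param (ha₀ t) (hZ t) (g := fun c x => x + c) (by fun_prop)
      fun n => (((B n).continuous.measurable.comp (hXm t)).add_const _).aestronglyMeasurable
  · exact ((B n).continuous.measurable.comp (hXm t)).add_const _

/-- Scaling operators are bounded along any set of times with bounded orbit. -/
theorem exists_norm_bound_scalingSet [IsProbabilityMeasure P] (hXm : ∀ t, Measurable (X t))
    (hXc : IsStochasticallyContinuous P X) (hXp : IsProper P X) {t : Vec d} (ht : t ≠ 0) (R : ℝ) :
    ∃ C : ℝ, ∀ s : ℝ, ‖expFlow A s t‖ ≤ R → ∀ B ∈ scalingSet P A X s, ‖B‖ ≤ C := by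
  obtain ⟨C, hC⟩ := exists_norm_bound_of_law_eq hXm hXc (hXm t) (hXp t ht) R
  refine ⟨C, fun s hs B ⟨a, ha⟩ => hC _ hs B (a t) ?_⟩
  exact ha.law_eq (fun _ => hXm _) (fun _ => by fun_prop) t

theorem isCompact_scalingSet [IsProbabilityMeasure P] (hXm : ∀ t, Measurable (X t))
    (hXc : IsStochasticallyContinuous P X) (hXp : IsProper P X) (hd : 0 < d) (s : ℝ) :
    IsCompact (scalingSet P A X s) := by
  refine Metric.isCompact_of_isClosed_isBounded ?_ ?_
  · refine isSeqClosed_iff_isClosed.1 fun B B₀ hB hlim => ?_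
    exact mem_scalingSet_of_tendsto hXm hXc tendsto_const_nhds hlim hB
  · have ht : (EuclideanSpace.single ⟨0, hd⟩ 1 : Vec d) ≠ 0 := by simp
    obtain ⟨C, hC⟩ := exists_norm_bound_scalingSet (A := A) hXm hXc hXp ht
      ‖expFlow A s (EuclideanSpace.single ⟨0, hd⟩ 1 : Vec d)‖
    exact isBounded_iff_forall_norm_le.2 ⟨C, hC s le_rfl⟩

end Scaling

end Fields

/-! ### Euler-type limits of powers. -/

section PowLimit

variable {𝔸 : Type*} [NormedRing 𝔸] [NormOneClass 𝔸]

theorem norm_pow_sub_pow_le_of_norm_le {x y : 𝔸} {r : ℝ} (hr : 1 ≤ r) (hx : ‖x‖ ≤ r) (hy : ‖y‖ ≤ r)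
    (k : ℕ) : ‖x ^ k - y ^ k‖ ≤ k * r ^ k * ‖x - y‖ := by
  induction k with
  | zero => simp
  | succ k ih =>
    have hr0 : 0 ≤ r := zero_le_one.trans hr
    have hxk : ‖x ^ k‖ ≤ r ^ k := (norm_pow_le x k).trans (pow_le_pow_left₀ (norm_nonneg x) hx k)
    calc ‖x ^ (k + 1) - y ^ (k + 1)‖ = ‖x ^ k * (x - y) + (x ^ k - y ^ k) * y‖ := by
          congr 1; rw [pow_succ, pow_succ]; noncomm_ring
      _ ≤ ‖x ^ k‖ * ‖x - y‖ + ‖x ^ k - y ^ k‖ * ‖y‖ :=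
          (norm_add_le _ _).trans (add_le_add (norm_mul_le _ _) (norm_mul_le _ _))
      _ ≤ r ^ k * ‖x - y‖ + (k * r ^ k * ‖x - y‖) * r := by gcongr
      _ ≤ (r ^ k * r) * ‖x - y‖ + (k * r ^ k * ‖x - y‖) * r := by
          gcongr
          exact le_mul_of_one_le_right (by positivity) hr
      _ = (k + 1 : ℕ) * r ^ (k + 1) * ‖x - y‖ := by push_cast; ring

variable [NormedAlgebra ℝ 𝔸] [CompleteSpace 𝔸]

/-- If `B n = 1 + c n L + o(c n)` and `k n * c n → τ` then `B n ^ k n → exp (τ L)`. -/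
theorem tendsto_pow_expFlow {B : ℕ → 𝔸} {L : 𝔸} {c : ℕ → ℝ} {k : ℕ → ℕ} {τ : ℝ}
    (hpos : ∀ n, 0 < c n) (hc : Tendsto c atTop (𝓝 0))
    (hB : Tendsto (fun n => (c n)⁻¹ • (B n - 1)) atTop (𝓝 L))
    (hk : Tendsto (fun n => k n * c n) atTop (𝓝 τ)) :
    Tendsto (fun n => B n ^ k n) atTop (𝓝 (expFlow L τ)) := by
  have hC := tendsto_expFlow_sub_one_div L hc hpos
  have hδ : Tendsto (fun n => ‖(c n)⁻¹ • (B n - 1) - (c n)⁻¹ • (expFlow L (c n) - 1)‖) atTop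
      (𝓝 0) := by simpa using (hB.sub hC).norm
  -- Both `B n` and `exp(c n L)` have norm at most `r = exp(c n (‖L‖ + 1))` eventually, and `r ^ k
  -- n` stays bounded since `k n * c n` converges. The telescoping estimate then gives a difference
  -- of powers of order `k n * o(c n)`.
  have hnorm : ∀ (D : ℕ → 𝔸), Tendsto (fun n => (c n)⁻¹ • (D n - 1)) atTop (𝓝 L) →
      ∀ᶠ n in atTop, ‖D n‖ ≤ Real.exp (c n * (‖L‖ + 1)) := fun D hD => by
    filter_upwards [hD.norm.eventually_lt_const (lt_add_one ‖L‖)] with n hn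
    have h1 : ‖D n - 1‖ ≤ c n * (‖L‖ + 1) := by
      rw [norm_smul, norm_inv, Real.norm_of_nonneg (hpos n).le, inv_mul_lt_iff₀ (hpos n)] at hn
      exact hn.le
    calc ‖D n‖ = ‖(D n - 1) + 1‖ := by simp
      _ ≤ ‖D n - 1‖ + 1 := by simpa using norm_add_le (D n - 1) 1
      _ ≤ c n * (‖L‖ + 1) + 1 := by gcongr
      _ ≤ _ := Real.add_one_le_exp _
  have hdiff : Tendsto (fun n => B n ^ k n - expFlow L (c n) ^ k n) atTop (𝓝 0) := by
    have hbound : Tendsto (fun n => k n * c n * Real.exp ((k n * c n) * (‖L‖ + 1)) *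
        ‖(c n)⁻¹ • (B n - 1) - (c n)⁻¹ • (expFlow L (c n) - 1)‖) atTop (𝓝 0) := by
      have h1 := (hk.mul ((Real.continuous_exp.tendsto _).comp (hk.mul_const (‖L‖ + 1)))).mul hδ
      simpa using h1
    refine squeeze_zero_norm' ?_ hbound
    filter_upwards [hnorm B hB, hnorm _ hC] with n h1 h2
    have hr : 1 ≤ Real.exp (c n * (‖L‖ + 1)) :=
      Real.one_le_exp (mul_nonneg (hpos n).le (by positivity))
    refine (norm_pow_sub_pow_le_of_norm_le hr h1 h2 (k n)).trans (le_of_eq ?_)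
    rw [← smul_sub, sub_sub_sub_cancel_right, norm_smul, norm_inv,
      Real.norm_of_nonneg (hpos n).le, ← Real.exp_nat_mul, ← mul_assoc (k n : ℝ) (c n)]
    field_simp [(hpos n).ne']
  have hlim : Tendsto (fun n => expFlow L (c n) ^ k n) atTop (𝓝 (expFlow L τ)) := by
    simp only [expFlow_pow]
    exact ((continuous_expFlow L).tendsto τ).comp hk
  simpa using hdiff.add hlim

end PowLimit

/-! ### Extraction of a one-parameter group of scaling operators. -/

section OneParameter

variable {Ω : Type*} [MeasurableSpace Ω] {P : Measure Ω} [IsProbabilityMeasure P]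
  {d m : ℕ} {X : Vec d → Ω → Vec m} {A : Vec d →L[ℝ] Vec d}

/-- Arbitrary scaling operators at times tending to `0` subconverge to some invertible `U` at time
`0`. Right multiplication by `U⁻¹` keeps the time and makes them tend to `1`; the minimisers, which
exist by compactness, are at least as close to `1`. -/
theorem exists_minimizers_scalingSet (hXm : ∀ t, Measurable (X t))
    (hXc : IsStochasticallyContinuous P X) (hXp : IsProper P X) (hd : 0 < d)
    (hne : ∀ s, (scalingSet P A X s).Nonempty) :
    ∃ (s : ℕ → ℝ) (B : ℕ → Vec m →L[ℝ] Vec m), (∀ n, 0 < s n) ∧ Tendsto s atTop (𝓝 0) ∧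
      (∀ n, B n ∈ scalingSet P A X (s n)) ∧
      (∀ n, ∀ C ∈ scalingSet P A X (s n), ‖B n - 1‖ ≤ ‖C - 1‖) ∧
      Tendsto (fun n => ‖B n - 1‖) atTop (𝓝 0) := by
  set t : Vec d := EuclideanSpace.single ⟨0, hd⟩ 1
  have ht : t ≠ 0 := by simp [t]
  set s : ℕ → ℝ := fun n => 1 / ((n : ℝ) + 1)
  have hspos : ∀ n, 0 < s n := fun n => Nat.one_div_pos_of_nat
  have hslim : Tendsto s atTop (𝓝 0) := tendsto_one_div_add_atTop_nhds_zero_nat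
  obtain ⟨R, hR⟩ : ∃ R, ∀ n, ‖expFlow A (s n) t‖ ≤ R := by
    have hcont : Continuous fun u : ℝ => expFlow A u t := by fun_prop
    have h1 := ((hcont.tendsto 0).comp hslim).norm.bddAbove_range
    obtain ⟨R, hR⟩ := h1
    exact ⟨R, fun n => hR ⟨n, rfl⟩⟩
  obtain ⟨K, hK⟩ := exists_norm_bound_scalingSet (A := A) hXm hXc hXp ht R
  choose C hC using fun n => hne (s n)
  obtain ⟨S, -, φ, hφ, hS⟩ := tendsto_subseq_of_bounded
    (Metric.isBounded_closedBall (x := (0 : Vec m →L[ℝ] Vec m)) (r := K)) (x := C)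
    fun n => mem_closedBall_zero_iff.2 (hK _ (hR n) _ (hC n))
  have hsφ := hslim.comp hφ.tendsto_atTop
  have hS0 : S ∈ scalingSet P A X 0 := mem_scalingSet_of_tendsto hXm hXc hsφ hS fun n => hC _
  obtain ⟨U, rfl⟩ := isUnit_of_mem_scalingSet hXm hd hXp hS0
  have hT : (↑U⁻¹ : Vec m →L[ℝ] Vec m) ∈ scalingSet P A X (-0) :=
    mem_scalingSet_of_mul_eq_one hXm hS0 U.inv_mul
  choose B hB hmin using fun n => (isCompact_scalingSet (A := A) hXm hXc hXp hd
    (s (φ n))).exists_isMinOn (hne _) (f := fun B => ‖B - 1‖) (by fun_prop)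
  refine ⟨s ∘ φ, B, fun n => hspos _, hsφ, hB, fun n C' hC' => hmin n hC', ?_⟩
  have hlim : Tendsto (fun n => ‖C (φ n) * ↑U⁻¹ - 1‖) atTop (𝓝 0) := by
    have := ((hS.mul_const (↑U⁻¹ : Vec m →L[ℝ] Vec m)).sub_const 1).norm
    simpa using this
  refine squeeze_zero (fun n => norm_nonneg _) (fun n => hmin n ?_) hlim
  have := mul_mem_scalingSet hXm (hC (φ n)) hT
  simpa using this

/-- The scaling operators contain a one-parameter group. -/
theorem exists_expFlow_mem_scalingSet (hXm : ∀ t, Measurable (X t))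
    (hXc : IsStochasticallyContinuous P X) (hXp : IsProper P X) (hd : 0 < d) (hm : 0 < m)
    (hne : ∀ s, (scalingSet P A X s).Nonempty) :
    ∃ D : Vec m →L[ℝ] Vec m, ∀ s, expFlow D s ∈ scalingSet P A X s := by
  have : Nonempty (Fin m) := ⟨⟨0, hm⟩⟩
  obtain ⟨s, B, hspos, hslim, hB, hmin, hBlim⟩ :=
    exists_minimizers_scalingSet hXm hXc hXp hd hne
  -- This normalisation makes `s n / c n` and `‖B n - 1‖ / c n` sum to one, so the limit `(L, σ)`
  -- cannot vanish.
  set c : ℕ → ℝ := fun n => s n + ‖B n - 1‖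
  have hcpos : ∀ n, 0 < c n := fun n => add_pos_of_pos_of_nonneg (hspos n) (norm_nonneg _)
  have hclim : Tendsto c atTop (𝓝 0) := by simpa using hslim.add hBlim
  have hvnorm : ∀ n, ‖(c n)⁻¹ • (B n - 1)‖ = (c n)⁻¹ * ‖B n - 1‖ := fun n => by
    rw [norm_smul, norm_inv, Real.norm_of_nonneg (hcpos n).le]
  have hsum : ∀ n, (c n)⁻¹ * s n + ‖(c n)⁻¹ • (B n - 1)‖ = 1 := fun n => by
    rw [hvnorm, ← mul_add]
    exact inv_mul_cancel₀ (hcpos n).ne'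
  have hσ0 : ∀ n, 0 ≤ (c n)⁻¹ * s n := fun n =>
    mul_nonneg (inv_nonneg.2 (hcpos n).le) (hspos n).le
  obtain ⟨⟨L, σ⟩, -, φ, hφ, hlim⟩ := tendsto_subseq_of_bounded
    (Metric.isBounded_closedBall (x := (0 : (Vec m →L[ℝ] Vec m) × ℝ)) (r := 1))
    (x := fun n => ((c n)⁻¹ • (B n - 1), (c n)⁻¹ * s n)) fun n => by
      rw [mem_closedBall_zero_iff, Prod.norm_def, Real.norm_of_nonneg (hσ0 n)]
      exact max_le (by linarith [hsum n, hσ0 n]) (by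
        linarith [hsum n, norm_nonneg ((c n)⁻¹ • (B n - 1))])
  have hL : Tendsto (fun n => (c (φ n))⁻¹ • (B (φ n) - 1)) atTop (𝓝 L) :=
    (continuous_fst.tendsto _).comp hlim
  have hσ : Tendsto (fun n => (c (φ n))⁻¹ * s (φ n)) atTop (𝓝 σ) :=
    (continuous_snd.tendsto _).comp hlim
  have hcφ : Tendsto (fun n => c (φ n)) atTop (𝓝 0) := hclim.comp hφ.tendsto_atTop
  have hsumlim : σ + ‖L‖ = 1 :=
    tendsto_nhds_unique (hσ.add hL.norm) (by simp only [hsum]; exact tendsto_const_nhds)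
  -- With `k = ⌊τ / c⌋`, the powers `B ^ k` tend to `exp(τL)` while their times `k s` tend to `τσ`.
  have hmem : ∀ τ, 0 ≤ τ → expFlow L τ ∈ scalingSet P A X (τ * σ) := fun τ hτ => by
    have hinv : Tendsto (fun n => (c (φ n))⁻¹) atTop atTop :=
      (tendsto_nhdsWithin_iff.2 ⟨hcφ, Eventually.of_forall fun n => hcpos _⟩).inv_tendsto_nhdsGT_zero
    have hk : Tendsto (fun n => (⌊τ * (c (φ n))⁻¹⌋₊ : ℝ) * c (φ n)) atTop (𝓝 τ) := by
      have := (tendsto_nat_floor_mul_div_atTop hτ).comp hinv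
      simpa [Function.comp_def, div_eq_mul_inv] using this
    refine mem_scalingSet_of_tendsto hXm hXc (hk.mul hσ)
      (tendsto_pow_expFlow (fun n => hcpos (φ n)) hcφ hL hk) fun n => ?_
    have := pow_mem_scalingSet hXm (hB (φ n)) ⌊τ * (c (φ n))⁻¹⌋₊
    rwa [mul_assoc, mul_inv_cancel_left₀ (hcpos (φ n)).ne']
  -- If `σ = 0`, then `exp(-cL)` is a scaling operator at time `0`. So `B exp(-cL)` competes with
  -- the minimiser `B` at the same time, yet lies within `o(c)` of `1`; this forces `L = 0`, against
  -- `σ + ‖L‖ = 1`.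
  have hσne : σ ≠ 0 := by
    rintro rfl
    have hneg : ∀ n, expFlow L (-c (φ n)) ∈ scalingSet P A X 0 := fun n => by
      have h1 := hmem (c (φ n)) (hcpos _).le
      have h2 := mem_scalingSet_of_mul_eq_one hXm h1 (expFlow_neg_mul L (c (φ n)))
      simpa using h2
    have hle : ∀ n, ‖(c (φ n))⁻¹ • (B (φ n) - 1)‖ ≤
        ‖((c (φ n))⁻¹ • (B (φ n) - 1)) * expFlow L (-c (φ n)) +
          (c (φ n))⁻¹ • (expFlow L (-c (φ n)) - 1)‖ := fun n => by
      have h1 := mul_mem_scalingSet hXm (hB (φ n)) (hneg n)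
      rw [add_zero] at h1
      have h2 := hmin _ _ h1
      have h3 : ((c (φ n))⁻¹ • (B (φ n) - 1)) * expFlow L (-c (φ n)) +
          (c (φ n))⁻¹ • (expFlow L (-c (φ n)) - 1) =
          (c (φ n))⁻¹ • (B (φ n) * expFlow L (-c (φ n)) - 1) := smul_sub_one_mul_add _ _ _
      rw [h3, norm_smul, norm_smul]
      gcongr
    have h1 : Tendsto (fun n => expFlow L (-c (φ n))) atTop (𝓝 1) := by
      have := ((continuous_expFlow L).tendsto (-0)).comp hcφ.neg
      rwa [neg_zero, expFlow_zero] at this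
    have h2 : Tendsto (fun n => (c (φ n))⁻¹ • (expFlow L (-c (φ n)) - 1)) atTop (𝓝 (-L)) :=
      tendsto_expFlow_neg_sub_one_div L hcφ fun n => hcpos _
    have h3 := le_of_tendsto_of_tendsto' hL.norm (((hL.mul h1).add h2).norm) hle
    simp only [mul_one, add_neg_cancel, norm_zero] at h3
    linarith
  have hpos : ∀ s, 0 ≤ s → expFlow (σ⁻¹ • L) s ∈ scalingSet P A X s := fun s hs => by
    have hσnn : 0 ≤ σ := ge_of_tendsto' hσ fun n => hσ0 _
    have := hmem (s * σ⁻¹) (mul_nonneg hs (inv_nonneg.2 hσnn))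
    rwa [inv_mul_cancel_right₀ hσne, ← expFlow_smul] at this
  refine ⟨σ⁻¹ • L, fun s => ?_⟩
  rcases le_total 0 s with hs | hs
  · exact hpos s hs
  · have h1 := hpos (-s) (neg_nonneg.2 hs)
    have h2 := mem_scalingSet_of_mul_eq_one hXm h1 (expFlow_mul_neg (σ⁻¹ • L) s)
    rwa [neg_neg] at h2

end OneParameter

/-! ### Spectrum and asymptotics of the exponential. -/

section GeneralizedEigenvectors

open scoped Nat

variable {V : Type*} [NormedAddCommGroup V] [NormedSpace ℂ V]

theorem isUnit_sub_smul_of_notMem_spectrum {T : V →L[ℂ] V} {z : ℂ} (hz : z ∉ spectrum ℂ T) :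
    IsUnit (T - z • 1) := by
  have := (spectrum.notMem_iff.1 hz).neg
  rwa [Algebra.algebraMap_eq_smul_one, neg_sub] at this

variable [CompleteSpace V]

theorem exp_apply_of_pow_apply_eq_zero {N : V →L[ℂ] V} {k : ℕ} {v : V} (h : (N ^ k) v = 0) :
    NormedSpace.exp N v = ∑ j ∈ Finset.range k, ((j ! : ℂ)⁻¹) • (N ^ j) v := by
  have h1 := (NormedSpace.exp_series_hasSum_exp' (𝕂 := ℂ) N).mapL (ContinuousLinearMap.apply ℂ V v)
  refine HasSum.unique (L := SummationFilter.unconditional ℕ) h1 ?_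
  have h2 := hasSum_sum_of_ne_finset_zero (L := SummationFilter.unconditional ℕ) (s := Finset.range k)
    (f := fun j => ContinuousLinearMap.apply ℂ V v (((j ! : ℂ)⁻¹) • N ^ j)) fun j hj => ?_
  · simp only [map_smul] at h2
    exact h2
  · obtain ⟨i, rfl⟩ := Nat.exists_eq_add_of_le (not_lt.1 (Finset.mem_range.not.1 hj))
    have h3 : (N ^ (k + i)) v = 0 := by
      rw [add_comm, pow_add, mul_apply_eq_comp, h, map_zero]
    simp [h3]

/-- Split `uT = uz + u(T - z)`: the summands commute, and the second has a terminating exponential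
series on `v`. All growth and decay statements below read off this product of `exp(uz)` and a
polynomial in `u`. -/
theorem exp_smul_apply_of_pow_sub_apply_eq_zero {T : V →L[ℂ] V} {z : ℂ} {k : ℕ} {v : V}
    (h : ((T - z • 1) ^ k) v = 0) (u : ℂ) :
    NormedSpace.exp (u • T) v =
      Complex.exp (u * z) • ∑ j ∈ Finset.range k, ((j ! : ℂ)⁻¹ * u ^ j) • ((T - z • 1) ^ j) v := by
  let _ : NormedAlgebra ℚ (V →L[ℂ] V) := NormedAlgebra.restrictScalars ℚ ℂ _
  have h1 : u • T = algebraMap ℂ (V →L[ℂ] V) (u * z) + u • (T - z • 1) := by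
    rw [Algebra.algebraMap_eq_smul_one, smul_sub, smul_smul, add_sub_cancel]
  have h2 : ((u • (T - z • 1)) ^ k) v = 0 := by
    rw [smul_pow, smul_apply, h, smul_zero]
  rw [h1, NormedSpace.exp_add_of_commute (Algebra.commutes _ _), mul_apply_eq_comp,
    exp_apply_of_pow_apply_eq_zero h2, ← NormedSpace.algebraMap_exp_comm,
    Algebra.algebraMap_eq_smul_one, ← Complex.exp_eq_exp_ℂ]
  rw [smul_apply, one_apply_eq_self]
  congr 1
  refine Finset.sum_congr rfl fun j _ => ?_
  rw [smul_pow, smul_apply, smul_smul]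

theorem exists_eigenvector_of_mem_spectrum [FiniteDimensional ℂ V] {T : V →L[ℂ] V} {z : ℂ}
    (hz : z ∈ spectrum ℂ T) : ∃ v ≠ 0, (T - z • 1) v = 0 := by
  by_contra! hcon
  refine hz ?_
  have hinj : Function.Injective (T - z • (1 : V →L[ℂ] V)) := by
    rw [injective_iff_map_eq_zero]
    intro v hv
    by_contra hne
    exact hcon v hne hv
  have hU : IsUnit (T - z • 1) := by
    rw [ContinuousLinearMap.isUnit_iff_bijective]
    exact ⟨hinj, (LinearMap.injective_iff_surjective (f := (T - z • 1).toLinearMap)).1 hinj⟩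
  have := hU.neg
  rwa [neg_sub, ← Algebra.algebraMap_eq_smul_one] at this

theorem tendsto_exp_neg_smul_apply [FiniteDimensional ℂ V] {T : V →L[ℂ] V}
    (hT : ∀ z ∈ spectrum ℂ T, 0 < z.re) (v : V) :
    Tendsto (fun u : ℝ => NormedSpace.exp ((-u : ℂ) • T) v) atTop (𝓝 0) := by
  -- The vectors with the claimed decay form a subspace, so it suffices to treat generalised
  -- eigenvectors, which span.
  let W : Submodule ℂ V :=
    { carrier := {v | Tendsto (fun u : ℝ => NormedSpace.exp ((-u : ℂ) • T) v) atTop (𝓝 0)}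
      zero_mem' := by
        change Tendsto _ _ _
        simp
      add_mem' := fun {v w} hv hw => by
        change Tendsto _ _ _
        have hv' : Tendsto _ _ _ := hv
        simpa using hv'.add hw
      smul_mem' := fun c v hv => by
        change Tendsto _ _ _
        have hv' : Tendsto _ _ _ := hv
        simpa using hv'.const_smul c }
  suffices hW : W = ⊤ by
    have : v ∈ W := hW ▸ Submodule.mem_top
    exact this
  rw [eq_top_iff, ← Module.End.iSup_maxGenEigenspace_eq_top T.toLinearMap]
  refine iSup_le fun z w hw => ?_
  change Tendsto _ _ _
  rw [Module.End.mem_maxGenEigenspace] at hw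
  obtain ⟨k, hk⟩ := hw
  have hk' : ((T - z • 1) ^ k) w = 0 := by
    rw [← hk, ← ContinuousLinearMap.coe_coe, ContinuousLinearMap.toLinearMap_pow]
    rfl
  by_cases hz : z ∈ spectrum ℂ T
  · have hre := hT z hz
    simp only [exp_smul_apply_of_pow_sub_apply_eq_zero hk', Finset.smul_sum, smul_smul]
    rw [← Finset.sum_const_zero (s := Finset.range k)]
    refine tendsto_finsetSum _ fun j _ => ?_
    rw [← zero_smul ℂ (((T - z • 1) ^ j) w)]
    refine Tendsto.smul_const ?_ _
    rw [tendsto_zero_iff_norm_tendsto_zero]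
    have h1 := (tendsto_rpow_mul_exp_neg_mul_atTop_nhds_zero j z.re hre).const_mul
      ((j ! : ℝ)⁻¹)
    rw [mul_zero] at h1
    refine h1.congr' ?_
    filter_upwards [eventually_ge_atTop 0] with u hu
    have h2 : ‖(j ! : ℂ)‖ = j ! := Complex.norm_natCast _
    rw [norm_mul, norm_mul, norm_inv, norm_pow, norm_neg, Complex.norm_real,
      Real.norm_of_nonneg hu, Complex.norm_exp, h2, Real.rpow_natCast]
    simp only [Complex.mul_re, Complex.neg_re, Complex.ofReal_re, Complex.neg_im,
      Complex.ofReal_im, neg_zero, zero_mul, sub_zero]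
    rw [neg_mul, neg_mul, mul_comm z.re u]
    ring
  · have hU := (isUnit_sub_smul_of_notMem_spectrum hz).pow k
    rw [ContinuousLinearMap.isUnit_iff_bijective] at hU
    have : w = 0 := hU.1 (by rw [hk', map_zero])
    subst this
    simp

/-- On an eigenvector the norm is `exp(-u Re z) ‖v‖`, unbounded if `Re z < 0`. -/
theorem re_nonneg_of_exp_bounded [FiniteDimensional ℂ V] {T : V →L[ℂ] V}
    (hT : ∀ v, ∃ C : ℝ, ∀ u : ℝ, 0 ≤ u → ‖NormedSpace.exp ((-u : ℂ) • T) v‖ ≤ C) {z : ℂ}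
    (hz : z ∈ spectrum ℂ T) : 0 ≤ z.re := by
  obtain ⟨v, hv, hTv⟩ := exists_eigenvector_of_mem_spectrum hz
  by_contra! hneg
  obtain ⟨C, hC⟩ := hT v
  have hpos : 0 < ‖v‖ := norm_pos_iff.2 hv
  have h1 : ∀ u : ℝ, ‖NormedSpace.exp ((-u : ℂ) • T) v‖ = Real.exp (u * -z.re) * ‖v‖ := fun u => by
    rw [exp_smul_apply_of_pow_sub_apply_eq_zero (k := 1) (z := z) (by simpa using hTv), norm_smul,
      Complex.norm_exp]
    simp
  have h2 : Tendsto (fun u : ℝ => Real.exp (u * -z.re) * ‖v‖) atTop atTop :=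
    (Real.tendsto_exp_atTop.comp
      (tendsto_id.atTop_mul_const (neg_pos.2 hneg))).atTop_mul_const hpos
  obtain ⟨u, hu, hu0⟩ := ((h2.eventually_gt_atTop C).and (eventually_ge_atTop 0)).exists
  linarith [hC u hu0, h1 u]

/-- If `(X - z)²q` is the minimal polynomial, some `w = q(T)x` satisfies `(T - z)w ≠ 0` and `(T -
z)²w = 0`. For `Re z = 0` the norm of `exp(-uT)w` is that of `w - u(T - z)w`, which grows linearly.
-/
theorem rootMultiplicity_minpoly_of_exp_bounded [FiniteDimensional ℂ V] {T : V →L[ℂ] V}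
    (hint : IsIntegral ℂ T)
    (hT : ∀ v, ∃ C : ℝ, ∀ u : ℝ, 0 ≤ u → ‖NormedSpace.exp ((-u : ℂ) • T) v‖ ≤ C) {z : ℂ}
    (hz : z ∈ spectrum ℂ T) (hre : z.re = 0) : (minpoly ℂ T).rootMultiplicity z = 1 := by
  have hne : minpoly ℂ T ≠ 0 := minpoly.ne_zero hint
  obtain ⟨v₀, hv₀, hTv₀⟩ := exists_eigenvector_of_mem_spectrum hz
  have : Nontrivial V := ⟨⟨v₀, 0, hv₀⟩⟩
  have hroot : (minpoly ℂ T).IsRoot z := by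
    have := spectrum.subset_polynomial_aeval T (minpoly ℂ T) ⟨z, hz, rfl⟩
    rw [minpoly.aeval, spectrum.zero_eq] at this
    simpa using this
  refine le_antisymm ?_ ((Polynomial.rootMultiplicity_pos hne).2 hroot)
  by_contra! hlt
  obtain ⟨q, hq⟩ := (Polynomial.le_rootMultiplicity_iff hne).1 (show 2 ≤ _ from hlt)
  have hmon : (Polynomial.X - Polynomial.C z : Polynomial ℂ).Monic := Polynomial.monic_X_sub_C z
  have hqmon : q.Monic := (hmon.pow 2).of_mul_monic_left (hq ▸ minpoly.monic hint)
  have hX : Polynomial.aeval T (Polynomial.X - Polynomial.C z : Polynomial ℂ) = T - z • 1 := by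
    simp [Algebra.algebraMap_eq_smul_one]
  have hne1 : Polynomial.aeval T ((Polynomial.X - Polynomial.C z) * q) ≠ 0 := by
    refine minpoly.aeval_ne_zero_of_dvdNotUnit_minpoly hint (hmon.mul hqmon)
      ⟨(hmon.mul hqmon).ne_zero, Polynomial.X - Polynomial.C z,
        Polynomial.not_isUnit_X_sub_C z, ?_⟩
    rw [hq]; ring
  have hzero : (T - z • 1) ^ 2 * Polynomial.aeval T q = 0 := by
    rw [← hX, ← map_pow, ← map_mul, ← hq, minpoly.aeval]
  rw [map_mul, hX] at hne1
  obtain ⟨x, hx⟩ : ∃ x, ((T - z • 1) * Polynomial.aeval T q) x ≠ 0 := by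
    by_contra! hcon
    exact hne1 (ContinuousLinearMap.ext hcon)
  set w := Polynomial.aeval T q x
  have hw2 : ((T - z • (1 : V →L[ℂ] V)) ^ 2) w = 0 :=
    congrArg (fun L : V →L[ℂ] V => L x) hzero
  have hw1 : 0 < ‖(T - z • (1 : V →L[ℂ] V)) w‖ := norm_pos_iff.2 hx
  obtain ⟨C, hC⟩ := hT w
  have h1 : ∀ u : ℝ, 0 ≤ u → u * ‖(T - z • 1) w‖ - ‖w‖ ≤ C := fun u hu => by
    refine le_trans ?_ (hC u hu)
    rw [exp_smul_apply_of_pow_sub_apply_eq_zero hw2, norm_smul, Complex.norm_exp]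
    have h2 : ((-u : ℂ) * z).re = 0 := by simp [hre]
    rw [h2, Real.exp_zero, one_mul]
    have h3 : ∑ j ∈ Finset.range 2, ((j ! : ℂ)⁻¹ * (-u : ℂ) ^ j) • ((T - z • 1) ^ j) w =
        w - (u : ℂ) • (T - z • 1) w := by
      simp only [Finset.sum_range_succ, Finset.sum_range_zero, zero_add, Nat.factorial_zero,
        Nat.factorial_one, Nat.cast_one, inv_one, one_mul, pow_zero, pow_one, one_smul, neg_smul,
        one_apply_eq_self, sub_eq_add_neg]
    rw [h3]
    have h4 : u * ‖(T - z • 1) w‖ = ‖(u : ℂ) • (T - z • 1) w‖ := by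
      rw [norm_smul, Complex.norm_real, Real.norm_of_nonneg hu]
    rw [h4, norm_sub_rev]
    exact norm_sub_norm_le _ _
  have h2 : Tendsto (fun u : ℝ => u * ‖(T - z • 1) w‖ - ‖w‖) atTop atTop :=
    tendsto_atTop_add_const_right _ _ (tendsto_id.atTop_mul_const hw1)
  obtain ⟨u, hu, hu0⟩ := ((h2.eventually_gt_atTop C).and (eventually_ge_atTop 0)).exists
  linarith [h1 u hu0]

end GeneralizedEigenvectors

/-! ### Transfer between real operators and their complexifications. -/

section RealToComplex

variable {n : ℕ}

theorem continuous_toEuclideanCLM :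
    Continuous (Matrix.toEuclideanCLM (n := Fin n) (𝕜 := ℝ)) :=
  LinearMap.continuous_of_finiteDimensional
    (Matrix.toEuclideanCLM (n := Fin n) (𝕜 := ℝ)).toAlgEquiv.toLinearMap

theorem opPow_eq_expFlow (r : ℝ) (A : Mat n) :
    opPow r A = expFlow (Matrix.toEuclideanCLM (n := Fin n) (𝕜 := ℝ) A) (Real.log r) := by
  let _ : NormedRing (Mat n) := Matrix.linftyOpNormedRing
  let _ : NormedAlgebra ℝ (Mat n) := Matrix.linftyOpNormedAlgebra
  let _ : NormedAlgebra ℚ (Mat n) := NormedAlgebra.restrictScalars ℚ ℝ _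
  let _ : NormedAlgebra ℚ (Vec n →L[ℝ] Vec n) := NormedAlgebra.restrictScalars ℚ ℝ _
  rw [opPow, expFlow, ← map_smul]
  exact NormedSpace.map_exp (Matrix.toEuclideanCLM (n := Fin n) (𝕜 := ℝ))
    continuous_toEuclideanCLM _

/-- The complexification of a real operator. -/
noncomputable def complexLift (n : ℕ) : (Vec n →L[ℝ] Vec n) →+*
    (EuclideanSpace ℂ (Fin n) →L[ℂ] EuclideanSpace ℂ (Fin n)) :=
  ((Matrix.toEuclideanCLM (n := Fin n) (𝕜 := ℂ)).toAlgEquiv.toRingEquiv.toRingHom.comp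
    Complex.ofRealHom.mapMatrix).comp
    (Matrix.toEuclideanCLM (n := Fin n) (𝕜 := ℝ)).symm.toAlgEquiv.toRingEquiv.toRingHom

theorem complexLift_toEuclideanCLM (A : Mat n) :
    complexLift n (Matrix.toEuclideanCLM (n := Fin n) (𝕜 := ℝ) A) =
      Matrix.toEuclideanCLM (n := Fin n) (𝕜 := ℂ) (complexify A) := by
  change Matrix.toEuclideanCLM (n := Fin n) (𝕜 := ℂ) (complexify
    ((Matrix.toEuclideanCLM (n := Fin n) (𝕜 := ℝ)).symm
      (Matrix.toEuclideanCLM (n := Fin n) (𝕜 := ℝ) A))) = _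
  rw [StarAlgEquiv.symm_apply_apply]

theorem continuous_complexLift : Continuous (complexLift n) := by
  have h1 : Continuous (Matrix.toEuclideanCLM (n := Fin n) (𝕜 := ℝ)).symm :=
    LinearMap.continuous_of_finiteDimensional
      (Matrix.toEuclideanCLM (n := Fin n) (𝕜 := ℝ)).symm.toAlgEquiv.toLinearMap
  have h2 : Continuous (Matrix.toEuclideanCLM (n := Fin n) (𝕜 := ℂ)) :=
    LinearMap.continuous_of_finiteDimensional
      (Matrix.toEuclideanCLM (n := Fin n) (𝕜 := ℂ)).toAlgEquiv.toLinearMap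
  have h3 : Continuous (complexify : Mat n → Matrix (Fin n) (Fin n) ℂ) :=
    continuous_id.matrix_map Complex.continuous_ofReal
  exact h2.comp (h3.comp h1)

theorem complexLift_smul (s : ℝ) (L : Vec n →L[ℝ] Vec n) :
    complexLift n (s • L) = (s : ℂ) • complexLift n L := by
  obtain ⟨A, rfl⟩ := EquivLike.surjective (Matrix.toEuclideanCLM (n := Fin n) (𝕜 := ℝ)) L
  rw [← map_smul, complexLift_toEuclideanCLM, complexLift_toEuclideanCLM, ← map_smul]
  congr 1
  ext i j
  simp [complexify]

theorem complexLift_expFlow (L : Vec n →L[ℝ] Vec n) (s : ℝ) :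
    complexLift n (expFlow L s) = NormedSpace.exp ((s : ℂ) • complexLift n L) := by
  let _ : NormedAlgebra ℚ (Vec n →L[ℝ] Vec n) := NormedAlgebra.restrictScalars ℚ ℝ _
  let _ : NormedAlgebra ℚ (EuclideanSpace ℂ (Fin n) →L[ℂ] EuclideanSpace ℂ (Fin n)) :=
    NormedAlgebra.restrictScalars ℚ ℂ _
  rw [← complexLift_smul]
  exact NormedSpace.map_exp (complexLift n) continuous_complexLift _

theorem norm_complexLift_apply (L : Vec n →L[ℝ] Vec n) (x : Vec n) :
    ‖complexLift n L (WithLp.toLp 2 fun i => (x i : ℂ))‖ = ‖L x‖ := by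
  obtain ⟨A, rfl⟩ := EquivLike.surjective (Matrix.toEuclideanCLM (n := Fin n) (𝕜 := ℝ)) L
  rw [complexLift_toEuclideanCLM, Matrix.toEuclideanCLM_toLp, EuclideanSpace.norm_eq,
    EuclideanSpace.norm_eq]
  congr 1
  refine Finset.sum_congr rfl fun i _ => ?_
  have h1 : (complexify A).mulVec (fun i => (x i : ℂ)) i = ((A.mulVec x.ofLp i : ℝ) : ℂ) := by
    simp [Matrix.mulVec, dotProduct, complexify]
  have h2 : (Matrix.toEuclideanCLM (n := Fin n) (𝕜 := ℝ) A x) i = A.mulVec x.ofLp i := by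
    rw [Matrix.ofLp_toEuclideanCLM]
  simp only [h1, h2, Complex.norm_real]

theorem spectrum_complexify (A : Mat n) :
    spectrum ℂ (Matrix.toEuclideanCLM (n := Fin n) (𝕜 := ℂ) (complexify A)) =
      spectrum ℂ (complexify A) :=
  AlgEquiv.spectrum_eq (Matrix.toEuclideanCLM (n := Fin n) (𝕜 := ℂ)).toAlgEquiv _

theorem tendsto_expFlow_neg_of_isQ {E : Mat n} (hE : IsQ E) (x : Vec n) :
    Tendsto (fun u : ℝ => expFlow (Matrix.toEuclideanCLM (n := Fin n) (𝕜 := ℝ) E) (-u) x)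
      atTop (𝓝 0) := by
  have h1 := tendsto_exp_neg_smul_apply
    (T := Matrix.toEuclideanCLM (n := Fin n) (𝕜 := ℂ) (complexify E))
    (fun z hz => hE.2 z (by rwa [spectrum_complexify] at hz))
    (WithLp.toLp 2 fun i => (x i : ℂ))
  rw [tendsto_zero_iff_norm_tendsto_zero] at h1 ⊢
  refine h1.congr fun u => ?_
  rw [← norm_complexLift_apply, complexLift_expFlow, complexLift_toEuclideanCLM]
  push_cast
  rfl

theorem isM_of_expFlow_bounded {D : Mat n} {C : ℝ}
    (hD : ∀ u : ℝ, 0 ≤ u →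
      ‖expFlow (Matrix.toEuclideanCLM (n := Fin n) (𝕜 := ℝ) D) (-u)‖ ≤ C) : IsM D := by
  -- The lift is used only as a continuous map: it sends the compact ball of radius `C` to a bounded
  -- set.
  obtain ⟨K, hK⟩ := ((isCompact_closedBall (0 : Vec n →L[ℝ] Vec n) C).image
    continuous_complexLift).isBounded.exists_norm_le
  have hbound : ∀ v, ∃ C' : ℝ, ∀ u : ℝ, 0 ≤ u → ‖NormedSpace.exp ((-u : ℂ) •
      Matrix.toEuclideanCLM (n := Fin n) (𝕜 := ℂ) (complexify D)) v‖ ≤ C' := fun v => by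
    refine ⟨K * ‖v‖, fun u hu => ?_⟩
    have h1 := hK _ ⟨_, mem_closedBall_zero_iff.2 (hD u hu), rfl⟩
    rw [complexLift_expFlow, complexLift_toEuclideanCLM] at h1
    push_cast at h1
    exact ContinuousLinearMap.le_of_opNorm_le _ h1 v
  intro z hz
  rw [← spectrum_complexify] at hz
  refine ⟨re_nonneg_of_exp_bounded hbound hz, fun hre => ?_⟩
  have hmin : minpoly ℂ (Matrix.toEuclideanCLM (n := Fin n) (𝕜 := ℂ) (complexify D)) =
      minpoly ℂ (complexify D) :=
    minpoly.algEquiv_eq (Matrix.toEuclideanCLM (n := Fin n) (𝕜 := ℂ)).toAlgEquiv _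
  rw [← hmin]
  refine rootMultiplicity_minpoly_of_exp_bounded ?_ hbound hz hre
  exact (Algebra.IsIntegral.isIntegral (R := ℂ) (complexify D)).map
    (Matrix.toEuclideanCLM (n := Fin n) (𝕜 := ℂ)).toAlgEquiv

end RealToComplex

/-! ### A radial coordinate for a contracting flow. -/

section Radial

variable {d : ℕ}

/-- Pointwise convergence to zero of operators of a Euclidean space is convergence in norm. -/
theorem tendsto_zero_of_forall_apply {ι : Type*} {l : Filter ι} {L : ι → Vec d →L[ℝ] Vec d}
    (h : ∀ x, Tendsto (fun i => L i x) l (𝓝 0)) : Tendsto L l (𝓝 0) := by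
  have h1 : ∀ i, L i = ∑ j, (EuclideanSpace.proj (𝕜 := ℝ) j).smulRight
      (L i (EuclideanSpace.single j 1)) := fun i => by
    refine ContinuousLinearMap.ext fun x => ?_
    have hx : x = ∑ j, x j • (EuclideanSpace.single j (1 : ℝ) : Vec d) := by
      have := (EuclideanSpace.basisFun (Fin d) ℝ).sum_repr x
      simpa using this.symm
    conv_lhs => rw [hx]
    simp
  rw [funext h1]
  have h2 : ∀ j : Fin d, Tendsto (fun i => (EuclideanSpace.proj (𝕜 := ℝ) j).smulRight
      (L i (EuclideanSpace.single j 1))) l (𝓝 (0 : Vec d →L[ℝ] Vec d)) := fun j => by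
    have h3 := ((ContinuousLinearMap.smulRightL ℝ (Vec d) (Vec d)
      (EuclideanSpace.proj (𝕜 := ℝ) j)).continuous.tendsto 0).comp (h (EuclideanSpace.single j 1))
    rwa [map_zero] at h3
  simpa using tendsto_finsetSum Finset.univ fun j _ => h2 j

/-- A continuous cutoff of the time spent by the orbit of `t` outside the unit ball. -/
noncomputable def orbitCutoff (A : Vec d →L[ℝ] Vec d) (v : ℝ) (t : Vec d) : ℝ :=
  1 - max 0 (min 1 (2 - ‖expFlow A v t‖))

theorem continuous_orbitCutoff (A : Vec d →L[ℝ] Vec d) {T : Type*} [TopologicalSpace T]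
    {f : T → ℝ} {g : T → Vec d} (hf : Continuous f) (hg : Continuous g) :
    Continuous fun x => orbitCutoff A (f x) (g x) := by
  have h : Continuous fun x => expFlow A (f x) (g x) :=
    ((continuous_expFlow A).comp hf).clm_apply hg
  unfold orbitCutoff
  fun_prop

theorem orbitCutoff_expFlow (A : Vec d →L[ℝ] Vec d) (v u : ℝ) (t : Vec d) :
    orbitCutoff A v (expFlow A u t) = orbitCutoff A (v + u) t := by
  rw [orbitCutoff, orbitCutoff, expFlow_add_apply]

/-- The orbit of `t` lies in the unit ball before time `-N` and outside the ball of radius `2`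
after time `N`. -/
def OrbitBound (A : Vec d →L[ℝ] Vec d) (N : ℝ) (t : Vec d) : Prop :=
  0 ≤ N ∧ ∀ v, N ≤ v → ‖expFlow A (-v) t‖ ≤ 1 ∧ 2 ≤ ‖expFlow A v t‖

variable {A : Vec d →L[ℝ] Vec d}

theorem exists_orbitBound (hA : ∀ x, Tendsto (fun u : ℝ => expFlow A (-u) x) atTop (𝓝 0))
    {t₀ : Vec d} (ht₀ : t₀ ≠ 0) : ∃ N, ∀ᶠ t in 𝓝 t₀, OrbitBound A N t := by
  have hnorm := (tendsto_zero_of_forall_apply hA).norm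
  rw [norm_zero] at hnorm
  have hpos : 0 < ‖t₀‖ := norm_pos_iff.2 ht₀
  -- If `‖exp(-vA)‖ ≤ ε`, the first term gives the bound `1` for backward orbits when `‖t‖ < ‖t₀‖ +
  -- 1`. The second gives the bound `2` for forward orbits when `‖t‖ > ‖t₀‖ / 2`.
  set ε : ℝ := min (1 / (‖t₀‖ + 1)) (‖t₀‖ / 4)
  have hε : 0 < ε := by positivity
  obtain ⟨N, hN⟩ := eventually_atTop.1 (hnorm.eventually_lt_const hε)
  refine ⟨max N 0, ?_⟩
  have h1 : ∀ᶠ t in 𝓝 t₀, ‖t‖ < ‖t₀‖ + 1 :=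
    (continuous_norm.tendsto t₀).eventually_lt_const (lt_add_one _)
  have h2 : ∀ᶠ t in 𝓝 t₀, ‖t₀‖ / 2 < ‖t‖ :=
    (continuous_norm.tendsto t₀).eventually_const_lt (half_lt_self hpos)
  filter_upwards [h1, h2] with t ht1 ht2
  refine ⟨le_max_right _ _, fun v hv => ?_⟩
  have hv' := (hN v ((le_max_left _ _).trans hv)).le
  constructor
  · calc ‖expFlow A (-v) t‖ ≤ ε * ‖t‖ := ContinuousLinearMap.le_of_opNorm_le _ hv' t
      _ ≤ 1 / (‖t₀‖ + 1) * (‖t₀‖ + 1) := by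
        gcongr
        exact min_le_left _ _
      _ = 1 := by field_simp
  · have h3 : ‖t‖ ≤ ε * ‖expFlow A v t‖ := by
      have h4 := expFlow_neg_apply A (-v) t
      rw [neg_neg] at h4
      conv_lhs => rw [← h4]
      exact ContinuousLinearMap.le_of_opNorm_le _ hv' _
    have h5 : ε * ‖expFlow A v t‖ ≤ ‖t₀‖ / 4 * ‖expFlow A v t‖ := by
      gcongr
      exact min_le_right _ _
    have h6 : ‖t₀‖ / 4 * 2 ≤ ‖t₀‖ / 4 * ‖expFlow A v t‖ := by linarith
    have h7 : 0 < ‖t₀‖ / 4 := by linarith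
    exact le_of_mul_le_mul_left h6 h7

/-- The cutoff is `0` before time `-N` and `1` after time `N`, so subtracting the upper limit makes
the integral independent of the window. -/
theorem OrbitBound.integral_eq {N : ℝ} {t : Vec d} (h : OrbitBound A N t) {a b : ℝ}
    (ha : a ≤ -N) (hb : N ≤ b) :
    (∫ v in a..b, orbitCutoff A v t) - b = (∫ v in -N..N, orbitCutoff A v t) - N := by
  have hcont : Continuous fun v => orbitCutoff A v t :=
    continuous_orbitCutoff A continuous_id continuous_const
  have hint : ∀ x y : ℝ, IntervalIntegrable (fun v => orbitCutoff A v t) volume x y :=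
    fun x y => hcont.intervalIntegrable x y
  have h1 : ∫ v in a..-N, orbitCutoff A v t = 0 := by
    rw [intervalIntegral.integral_congr (g := fun _ => (0 : ℝ)), intervalIntegral.integral_zero]
    intro v hv
    rw [Set.uIcc_of_le ha] at hv
    have := (h.2 (-v) (by linarith [hv.2])).1
    rw [neg_neg] at this
    simp only [orbitCutoff]
    rw [min_eq_left (by linarith), max_eq_right zero_le_one, sub_self]
  have h2 : ∫ v in N..b, orbitCutoff A v t = b - N := by
    rw [intervalIntegral.integral_congr (g := fun _ => (1 : ℝ)), intervalIntegral.integral_const,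
      smul_eq_mul, mul_one]
    intro v hv
    rw [Set.uIcc_of_le hb] at hv
    have := (h.2 v hv.1).2
    simp only [orbitCutoff]
    rw [max_eq_left ((min_le_right _ _).trans (by linarith)), sub_zero]
  rw [← intervalIntegral.integral_add_adjacent_intervals (hint a (-N)) (hint (-N) b),
    ← intervalIntegral.integral_add_adjacent_intervals (hint (-N) N) (hint N b), h1, h2]
  ring

theorem OrbitBound.integral_eq_integral {M N : ℝ} {t : Vec d} (hM : OrbitBound A M t)
    (hN : OrbitBound A N t) {a b : ℝ} (ha : a ≤ -M) (hb : M ≤ b) :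
    (∫ v in a..b, orbitCutoff A v t) - b = (∫ v in -N..N, orbitCutoff A v t) - N := by
  have h1 : min a (-N) ≤ -M := (min_le_left _ _).trans ha
  have h2 : M ≤ max b N := hb.trans (le_max_left _ _)
  have h3 : min a (-N) ≤ -N := min_le_right _ _
  have h4 : N ≤ max b N := le_max_right _ _
  exact ((hM.integral_eq ha hb).trans (hM.integral_eq h1 h2).symm).trans (hN.integral_eq h3 h4)

/-- There is a continuous logarithmic radial coordinate for the flow of a contracting generator. -/
theorem exists_radial (hA : ∀ x, Tendsto (fun u : ℝ => expFlow A (-u) x) atTop (𝓝 0)) :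
    ∃ h : Vec d → ℝ, ContinuousOn h {0}ᶜ ∧ ∀ u, ∀ t ≠ 0, h (expFlow A u t) = u + h t := by
  have hex : ∀ t : Vec d, ∃ N, t ≠ 0 → OrbitBound A N t := fun t => by
    by_cases ht : t = 0
    · exact ⟨0, fun h => absurd ht h⟩
    · obtain ⟨N, hN⟩ := exists_orbitBound hA ht
      exact ⟨N, fun _ => hN.self_of_nhds⟩
  choose N hN using hex
  -- The coordinate is a renormalised time spent outside the ball; translating the time variable by
  -- `u` changes it by exactly `u`.
  refine ⟨fun t => (∫ v in -N t..N t, orbitCutoff A v t) - N t, fun t₀ ht₀ => ?_,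
    fun u t ht => ?_⟩
  · obtain ⟨M, hM⟩ := exists_orbitBound hA (Set.mem_compl_singleton_iff.1 ht₀)
    have hcont : Continuous fun t => (∫ v in -M..M, orbitCutoff A v t) - M := by
      refine Continuous.sub ?_ continuous_const
      refine intervalIntegral.continuous_parametric_intervalIntegral_of_continuous' ?_ _ _
      change Continuous fun p : Vec d × ℝ => orbitCutoff A p.2 p.1
      exact continuous_orbitCutoff A continuous_snd continuous_fst
    refine (hcont.continuousAt.congr ?_).continuousWithinAt
    filter_upwards [hM, isOpen_compl_singleton.mem_nhds ht₀] with t h1 h2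
    exact h1.integral_eq_integral (hN t h2) le_rfl le_rfl
  · have htu : expFlow A u t ≠ 0 := fun h0 => ht (by
      have := expFlow_neg_apply A (-u) t
      rwa [neg_neg, h0, map_zero, eq_comm] at this)
    -- Large enough for `[-M, M]` to be admissible for the moved point and `[-M + u, M + u]` for
    -- `t`.
    set M := max (N (expFlow A u t)) (N t + |u|)
    have h1 : N (expFlow A u t) ≤ M := le_max_left _ _
    have h2 : N t + |u| ≤ M := le_max_right _ _
    have h3 := (hN _ htu).integral_eq_integral (hN _ htu) (neg_le_neg h1) h1
    have h4 := (hN t ht).integral_eq_integral (a := -M + u) (b := M + u) (hN t ht)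
      (by linarith [le_abs_self u]) (by linarith [neg_abs_le u])
    have h5 : ∫ v in -M..M, orbitCutoff A v (expFlow A u t) =
        ∫ v in -M + u..M + u, orbitCutoff A v t := by
      simp only [orbitCutoff_expFlow]
      exact intervalIntegral.integral_comp_add_right (fun v => orbitCutoff A v t) u
    beta_reduce
    rw [← h3, ← h4, h5]
    ring

end Radial

/-! ### The shifts as a continuous cocycle and coboundary. -/

section Cocycle

variable {Ω : Type*} [MeasurableSpace Ω] {P : Measure Ω} [IsProbabilityMeasure P]
  {d m : ℕ} {X : Vec d → Ω → Vec m} {A : Vec d →L[ℝ] Vec d} {D : Vec m →L[ℝ] Vec m}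
  {β : ℝ → Vec d → Vec m}

/-- The shifts of a one-parameter affine scaling form a cocycle. -/
theorem shift_cocycle (hXm : ∀ t, Measurable (X t))
    (h : ∀ s, FieldEqDist P (fun t ω => X (expFlow A s t) ω)
      (fun t ω => expFlow D s (X t ω) + β s t)) (s u : ℝ) (t : Vec d) :
    β (s + u) t = expFlow D s (β u t) + β s (expFlow A u t) := by
  have h1 := (h (s + u)).law_eq (fun _ => hXm _) (fun _ => by fun_prop) t
  have h2 := (h s).law_eq (fun _ => hXm _) (fun _ => by fun_prop) (expFlow A u t)
  have h3 := ((h u).map (fun _ => hXm _) (fun _ => by fun_prop)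
    (g := fun _ v => expFlow D s v + β s (expFlow A u t)) (fun _ => by fun_prop)).law_eq
    (fun _ => by fun_prop) (fun _ => by fun_prop) t
  have hZ : Measurable fun ω => expFlow D (s + u) (X t ω) := by fun_prop
  refine shift_unique (P := P) hZ ?_
  rw [← h1, expFlow_add_apply, h2, h3]
  congr 1
  ext1 ω
  rw [expFlow_add_apply, map_add, add_assoc]

/-- The shifts of a one-parameter affine scaling are jointly continuous. -/
theorem shift_continuous (hXm : ∀ t, Measurable (X t)) (hXc : IsStochasticallyContinuous P X)
    (h : ∀ s, FieldEqDist P (fun t ω => X (expFlow A s t) ω)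
      (fun t ω => expFlow D s (X t ω) + β s t)) :
    Continuous fun p : ℝ × Vec d => β p.1 p.2 := by
  refine continuous_iff_seqContinuous.2 fun p p₀ hp => ?_
  have hp1 : Tendsto (fun n => (p n).1) atTop (𝓝 p₀.1) := (continuous_fst.tendsto _).comp hp
  have hp2 : Tendsto (fun n => (p n).2) atTop (𝓝 p₀.2) := (continuous_snd.tendsto _).comp hp
  have hA : Continuous fun p : ℝ × Vec d => expFlow A p.1 p.2 :=
    ((continuous_expFlow A).comp continuous_fst).clm_apply continuous_snd
  have hY := hXc.tendsto ((hA.tendsto p₀).comp hp)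
  have hZ := tendstoInMeasure_continuous_param (((continuous_expFlow D).tendsto _).comp hp1)
    (hXc.tendsto hp2) (g := fun (L : Vec m →L[ℝ] Vec m) (v : Vec m) => L v) (by fun_prop)
    (fun n => ((expFlow D (p n).1).continuous.measurable.comp (hXm _)).aestronglyMeasurable)
  have hlaw : ∀ q : ℝ × Vec d, P.map (X (expFlow A q.1 q.2)) =
      P.map (fun ω => expFlow D q.1 (X q.2 ω) + β q.1 q.2) := fun q =>
    (h q.1).law_eq (fun _ => hXm _) (fun _ => by fun_prop) q.2
  have hZm : Measurable fun ω => expFlow D p₀.1 (X p₀.2 ω) := by fun_prop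
  obtain ⟨a, ha, hlim⟩ := shift_tendsto (a := fun n => β (p n).1 (p n).2) hY hZ (fun n => hXm _)
    (fun n => (expFlow D (p n).1).continuous.measurable.comp (hXm _)) (hXm _) hZm
    fun n => hlaw (p n)
  have : a = β p₀.1 p₀.2 := shift_unique hZm (hlim.symm.trans (hlaw p₀))
  exact this ▸ ha

/-- A continuous cocycle over a contracting flow is a coboundary away from the origin. -/
theorem exists_drift (hA : ∀ x, Tendsto (fun u : ℝ => expFlow A (-u) x) atTop (𝓝 0))
    (hβ : Continuous fun p : ℝ × Vec d => β p.1 p.2)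
    (hco : ∀ s u t, β (s + u) t = expFlow D s (β u t) + β s (expFlow A u t)) :
    ∃ b : Vec d → Vec m, ContinuousOn b {0}ᶜ ∧
      ∀ s, ∀ t ≠ 0, β s t = b (expFlow A s t) - expFlow D s (b t) := by
  obtain ⟨h, hcont, hh⟩ := exists_radial hA
  -- Flow `t` back to the section `h = 0` and take the shift accumulated from there. Points of one
  -- orbit share their section point, so the cocycle identity gives the coboundary equation.
  refine ⟨fun t => β (h t) (expFlow A (-h t) t), ?_, fun s t ht => ?_⟩
  · have hflow : Continuous fun p : ℝ × Vec d => expFlow A p.1 p.2 :=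
      ((continuous_expFlow A).comp continuous_fst).clm_apply continuous_snd
    exact hβ.comp_continuousOn (hcont.prodMk
      (hflow.comp_continuousOn (hcont.neg.prodMk continuousOn_id)))
  · simp only
    rw [hh s t ht, ← expFlow_add_apply, neg_add_rev, neg_add_cancel_right, hco s (h t),
      expFlow_neg_apply, add_sub_cancel_left]

end Cocycle

/-! ### Assembly for the field and its exponents. -/

section Main

variable {Ω : Type*} [MeasurableSpace Ω] {P : Measure Ω} {d m : ℕ} {X : Vec d → Ω → Vec m}
  {E : Mat d} {D : Mat m} {β : ℝ → Vec d → Vec m}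

theorem IsWOSS.scalingSet_nonempty (h : IsWOSS P E X) (s : ℝ) :
    (scalingSet P (Matrix.toEuclideanCLM (n := Fin d) (𝕜 := ℝ) E) X s).Nonempty := by
  obtain ⟨B, a, hB⟩ := h (Real.exp s) (Real.exp_pos s)
  simp only [opPow_eq_expFlow, Real.log_exp] at hB
  exact ⟨_, a, hB⟩

theorem IsWOSSWith.expFlow (h : IsWOSSWith P E D β X) (s : ℝ) :
    FieldEqDist P (fun t ω => X (expFlow (Matrix.toEuclideanCLM (n := Fin d) (𝕜 := ℝ) E) s t) ω)
      (fun t ω => expFlow (Matrix.toEuclideanCLM (n := Fin m) (𝕜 := ℝ) D) s (X t ω) +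
        β (Real.exp s) t) := by
  have := h (Real.exp s) (Real.exp_pos s)
  simpa only [opPow_eq_expFlow, Real.log_exp] using this

theorem exists_norm_bound_expFlow_neg_of_isQ (hE : IsQ E) (t : Vec d) :
    ∃ R, ∀ u : ℝ, 0 ≤ u →
      ‖expFlow (Matrix.toEuclideanCLM (n := Fin d) (𝕜 := ℝ) E) (-u) t‖ ≤ R := by
  set A := Matrix.toEuclideanCLM (n := Fin d) (𝕜 := ℝ) E
  have hlim := (tendsto_expFlow_neg_of_isQ hE t).norm
  rw [norm_zero] at hlim
  obtain ⟨N, hN⟩ := eventually_atTop.1 (hlim.eventually_lt_const one_pos)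
  have hcont : Continuous fun u : ℝ => expFlow A (-u) t := by fun_prop
  obtain ⟨K, hK⟩ := ((isCompact_Icc (a := (0 : ℝ)) (b := N)).image hcont).isBounded.exists_norm_le
  refine ⟨max K 1, fun u hu => ?_⟩
  rcases le_total u N with h | h
  · exact (hK _ ⟨u, ⟨hu, h⟩, rfl⟩).trans (le_max_left _ _)
  · exact (hN u h).le.trans (le_max_right _ _)

theorem isOSSOn_of_drift (hXm : ∀ t, Measurable (X t)) (h : IsWOSSWith P E D β X) {S : Set (Vec d)}
    {b : Vec d → Vec m}
    (hb : ∀ r : ℝ, 0 < r → ∀ t ∈ S, β r t = b (opPow r E t) - opPow r D (b t)) :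
    IsOSSOn P S E D (fun t ω => X t ω - b t) := by
  intro r hr
  have h1 := ((h r hr).reindex (fun _ => hXm _) (fun _ => by fun_prop)
    (fun t : S => (t : Vec d))).map (fun _ => hXm _) (fun _ => by fun_prop)
    (g := fun t v => v - b (opPow r E t)) (fun _ => by fun_prop)
  convert h1 using 3 with t ω
  rw [hb r hr t t.2, map_sub]
  abel

variable [IsProbabilityMeasure P]

theorem exists_exponent (hd : 0 < d) (hm : 0 < m) (hE : IsQ E) (hXm : ∀ t, Measurable (X t))
    (hXc : IsStochasticallyContinuous P X) (hXp : IsProper P X) (hX : IsWOSS P E X) :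
    ∃ (D : Mat m) (β : ℝ → Vec d → Vec m), IsM D ∧
      ContinuousOn (fun p : ℝ × Vec d => β p.1 p.2) (Set.Ioi (0 : ℝ) ×ˢ Set.univ) ∧
      IsWOSSWith P E D β X := by
  obtain ⟨L, hL⟩ := exists_expFlow_mem_scalingSet hXm hXc hXp hd hm hX.scalingSet_nonempty
  obtain ⟨D, rfl⟩ := EquivLike.surjective (Matrix.toEuclideanCLM (n := Fin m) (𝕜 := ℝ)) L
  choose β hβ using id hL
  refine ⟨D, fun r t => β (Real.log r) t, ?_, ?_, fun r hr => ?_⟩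
  · have ht : (EuclideanSpace.single ⟨0, hd⟩ 1 : Vec d) ≠ 0 := by simp
    -- The backward orbit of one nonzero vector is bounded, hence so are the scaling operators
    -- `exp(-uD)` for `u ≥ 0`.
    obtain ⟨R, hR⟩ := exists_norm_bound_expFlow_neg_of_isQ hE (EuclideanSpace.single ⟨0, hd⟩ 1)
    obtain ⟨C, hC⟩ := exists_norm_bound_scalingSet hXm hXc hXp ht R
    exact isM_of_expFlow_bounded fun u hu => hC _ (hR u hu) _ (hL _)
  · refine (shift_continuous hXm hXc hβ).comp_continuousOn (ContinuousOn.prodMk ?_ ?_)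
    · exact Real.continuousOn_log.comp continuousOn_fst fun p hp => (ne_of_gt hp.1 : p.1 ≠ 0)
    · exact continuousOn_snd
  · simp only [opPow_eq_expFlow]
    exact hβ (Real.log r)

theorem IsWOSSWith.exists_drift (hE : IsQ E) (hXm : ∀ t, Measurable (X t))
    (hXc : IsStochasticallyContinuous P X) (h : IsWOSSWith P E D β X) :
    ∃ b : Vec d → Vec m, ContinuousOn b {0}ᶜ ∧
      ∀ r : ℝ, 0 < r → ∀ t, t ≠ 0 → β r t = b (opPow r E t) - opPow r D (b t) := by
  obtain ⟨b, hb, hbeq⟩ := OperatorScaling.exists_drift (tendsto_expFlow_neg_of_isQ hE)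
    (shift_continuous hXm hXc h.expFlow) (shift_cocycle hXm h.expFlow)
  refine ⟨b, hb, fun r hr t ht => ?_⟩
  have := hbeq (Real.log r) t ht
  rwa [Real.exp_log hr, ← opPow_eq_expFlow, ← opPow_eq_expFlow] at this

/-- The origin is fixed by `r ^ E`, so the scaling identity there compares two constants. -/
theorem IsWOSSWith.shift_zero (hXm : ∀ t, Measurable (X t)) (h : IsWOSSWith P E D β X)
    {a : Vec m} (ha : ∀ᵐ ω ∂P, X 0 ω = a) {r : ℝ} (hr : 0 < r) :
    β r 0 = a - opPow r D a := by
  have h1 := (h r hr).law_eq (fun _ => hXm _) (fun _ => by fun_prop) 0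
  rw [map_zero] at h1
  have h2 : P.map (X 0) = P.map (fun _ => (0 : Vec m) + a) :=
    Measure.map_congr (ha.mono fun ω hω => by simpa using hω)
  have h3 : P.map (fun ω => opPow r D (X 0 ω) + β r 0) =
      P.map (fun _ => (0 : Vec m) + (opPow r D a + β r 0)) :=
    Measure.map_congr (ha.mono fun ω hω => by simp [hω])
  have h4 := shift_unique (P := P) (Z := fun _ => (0 : Vec m)) measurable_const
    (h2.symm.trans (h1.trans h3))
  exact eq_sub_of_add_eq' h4.symm

theorem opPow_apply_ne_zero (r : ℝ) {t : Vec d} (ht : t ≠ 0) : opPow r E t ≠ 0 := by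
  rw [opPow_eq_expFlow]
  intro h0
  have := expFlow_neg_apply (Matrix.toEuclideanCLM (n := Fin d) (𝕜 := ℝ) E) (-Real.log r) t
  rw [neg_neg, h0, map_zero] at this
  exact ht this.symm

theorem IsWOSSWith.update_drift (hXm : ∀ t, Measurable (X t)) (h : IsWOSSWith P E D β X)
    {b : Vec d → Vec m}
    (hb : ∀ r : ℝ, 0 < r → ∀ t, t ≠ 0 → β r t = b (opPow r E t) - opPow r D (b t))
    {a : Vec m} (ha : ∀ᵐ ω ∂P, X 0 ω = a) {r : ℝ} (hr : 0 < r) (t : Vec d) :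
    β r t = Function.update b 0 a (opPow r E t) - opPow r D (Function.update b 0 a t) := by
  rcases eq_or_ne t 0 with rfl | ht
  · rw [map_zero, Function.update_self]
    exact h.shift_zero hXm ha hr
  · rw [Function.update_of_ne ht, Function.update_of_ne (opPow_apply_ne_zero r ht)]
    exact hb r hr t ht

end Main

end OperatorScaling

theorem mainTheorem3 {Ω : Type*} [MeasurableSpace Ω] (P : Measure Ω) [IsProbabilityMeasure P]
    (d m : ℕ) (hd : 2 ≤ d) (hm : 2 ≤ m)
    (E : OperatorScaling.Mat d) (hE : OperatorScaling.IsQ E)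
    (X : OperatorScaling.Vec d → Ω → OperatorScaling.Vec m)
    (hXmeas : ∀ t, Measurable (X t))
    (hXcont : OperatorScaling.IsStochasticallyContinuous P X)
    (hXproper : OperatorScaling.IsProper P X)
    (hXwoss : OperatorScaling.IsWOSS P E X) :
    -- there are an exponent in the class `M` and a jointly continuous scaling function
    (∃ (D : OperatorScaling.Mat m)
        (β : ℝ → OperatorScaling.Vec d → OperatorScaling.Vec m),
      OperatorScaling.IsM D ∧
      ContinuousOn (fun p : ℝ × OperatorScaling.Vec d => β p.1 p.2)
        (Set.Ioi (0 : ℝ) ×ˢ (Set.univ : Set (OperatorScaling.Vec d))) ∧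
      OperatorScaling.IsWOSSWith P E D β X) ∧
    -- and every such pair admits a drift function
    (∀ (D : OperatorScaling.Mat m)
        (β : ℝ → OperatorScaling.Vec d → OperatorScaling.Vec m),
      OperatorScaling.IsWOSSWith P E D β X →
      ∃ b : OperatorScaling.Vec d → OperatorScaling.Vec m,
        ContinuousOn b {0}ᶜ ∧
        (∀ r : ℝ, 0 < r → ∀ t : OperatorScaling.Vec d, t ≠ 0 →
          β r t = b (OperatorScaling.opPow r E t) - OperatorScaling.opPow r D (b t)) ∧
        OperatorScaling.IsOSSOn P {0}ᶜ E D (fun t ω => X t ω - b t) ∧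
        (∀ a : OperatorScaling.Vec m, OperatorScaling.IsQ D → (∀ᵐ ω ∂P, X 0 ω = a) →
          (∀ r : ℝ, 0 < r → ∀ t : OperatorScaling.Vec d,
            β r t = Function.update b 0 a (OperatorScaling.opPow r E t)
              - OperatorScaling.opPow r D (Function.update b 0 a t)) ∧
          OperatorScaling.IsOSSOn P Set.univ E D
            (fun t ω => X t ω - Function.update b 0 a t))) := by
  refine ⟨OperatorScaling.exists_exponent (by omega) (by omega) hE hXmeas hXcont hXproper hXwoss,
    fun D β h => ?_⟩
  obtain ⟨b, hb, hbeq⟩ := h.exists_drift hE hXmeas hXcont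
  refine ⟨b, hb, hbeq, OperatorScaling.isOSSOn_of_drift hXmeas h fun r hr t ht => hbeq r hr t ht,
    fun a _ ha => ⟨fun r hr t => h.update_drift hXmeas hbeq ha hr t,
      OperatorScaling.isOSSOn_of_drift hXmeas h fun r hr t _ => h.update_drift hXmeas hbeq ha hr t⟩⟩
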